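/- There are an absolute constant $C$ and a single program $P$ for a unit-cost random access machine (addition, truncated subtraction, comparison and indirect addressing of natural numbers each take one step) such that the following holds. Let $k, g, N_1, N_2$ be positive integers and put $h := 2N_1 - N_2$ (an integer, possibly negative). Assume $1 \le k \le N_2$, $g + h > 2$ and $2k - 4g - h + 3 \le N_2 \le 2k + g + h - 2$. Let $T$ be a tree with $N_1$ vertices and let $c$ assign to every vertex a positive integer $c(v) \le k$, with $\sum_{v \in V(T)} c(v) = N_2$. For a subgraph $H$ of $T$ write $c(H) := \sum_{v \in V(H)} c(v)$. 1. $T$ has a (nonempty) subtree $S$ with $k - g + 1 \le c(S) \le k$. 2. Fix, for every vertex of $T$, a cyclic order of its incident edges (as given by a planar embedding of $T$), and let $C_T$ be the corresponding Euler tour: its vertices are the pairs $(v, e)$ with $v$ an end of the edge $e$, and the successor of $(u, uv)$ is $(v, e')$, where $e'$ follows $uv$ in the cyclic order at $v$. For $s, t \in V(C_T)$ let $[s, t]$ be the directed path from $s$ to $t$ along $C_T$, let $\rho([s, t])$ be the subtree of $T$ induced by the first coordinates of its vertices, and put $c([s,t]) := c(\rho([s,t]))$. The overload–discharge search starts with $s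 = t$ equal to any vertex of $C_T$ and repeats: (i) while $c([s,t]) < k - g + 1$, replace $t$ by its successor; then, if $c([s,t]) \le k$, output $\rho([s,t])$ and stop; (ii) while $c([s,t]) > k$, replace $s$ by its successor; then, if $c([s,t]) \ge k - g + 1$, output $\rho([s,t])$ and stop, otherwise go back to (i). For every choice of the cyclic orders and of the start, the search stops after at most $C N_1$ moves (pointer moves and changes of loop), and its output is a subtree $S$ with $k - g + 1 \le c(S) \le k$. 3. Given $N_1$, $k$, $g$, the weights of the vertices (numbered $0, \dots, N_1 - 1$ in any way) and the list of the edges of $T$ (in any order, each as a pair of its ends in any order), the program $P$ halts within $C N_1$ steps and outputs the indicator vector of the vertex set of a subtree $S$ of $T$ with $k - g + 1 \le c(S) \le k$; if $N_1 \ge 2$, this $S$ is the output of the overload–discharge search for some choice of the cyclic orders and of the start. -/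

import Mathlib

namespace SimpleGraph

/-- The weight `c(H)` of a subgraph `H`: the sum of the weights of its vertices. -/
noncomputable def subgraphWeight {V : Type*} [Fintype V] {T : SimpleGraph V}
    (c : V → ℕ) (H : T.Subgraph) : ℕ :=
  open Classical in ∑ v with v ∈ H.verts, c v

/-- `S` is a subtree (a connected acyclic subgraph, in particular nonempty)
with `k - g + 1 ≤ c(S) ≤ k`. -/
def IsSubtreeOfWeight {V : Type*} [Fintype V] {T : SimpleGraph V}
    (c : V → ℕ) (k g : ℕ) (S : T.Subgraph) : Prop :=
  S.coe.IsTree ∧ (k : ℤ) - g + 1 ≤ subgraphWeight c S ∧ subgraphWeight c S ≤ k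

/-- A cyclic enumeration of the edges at every vertex, as given by a planar embedding of a tree
(for a tree, each such enumeration comes from a planar embedding). The edge `vw`, as an edge
at `v`, is represented by the dart `(v, w)`. -/
structure RotationSystem {V : Type*} (T : SimpleGraph V) where
  /-- the dart that follows `d` in the cyclic order of the darts leaving `d.fst` -/
  rot : Equiv.Perm T.Dart
  fst_rot : ∀ d, (rot d).fst = d.fst
  sameCycle : ∀ d d' : T.Dart, d.fst = d'.fst → rot.SameCycle d d'

namespace RotationSystem

variable {V : Type*} {T : SimpleGraph V}

/-- The successor `d⁺` in the Euler tour `C_T`. Its vertices are the darts `d` of `T`, the dart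
`d` being mapped by `ρ` to the vertex `d.fst`: one walks along the edge of `d` to its other end,
and takes there the next edge in the cyclic order. -/
def tourNext (R : RotationSystem T) (d : T.Dart) : T.Dart :=
  R.rot d.symm

/-- The vertices of the directed path `[s, t]` from `s` to `t` along the Euler tour: those
reached from `s` without leaving `t`. -/
def tourPath (R : RotationSystem T) (s t : T.Dart) : Set T.Dart :=
  {d | ∃ i : ℕ, R.tourNext^[i] s = d ∧ ∀ j < i, R.tourNext^[j] s ≠ t}

/-- `ρ([s, t])`: the subgraph of `T` induced by the image of the path `[s, t]`. -/
def tourSubtree (R : RotationSystem T) (s t : T.Dart) : T.Subgraph :=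
  (⊤ : T.Subgraph).induce ((fun d : T.Dart => d.fst) '' R.tourPath s t)

/-- The two loops of the overload-discharge search. -/
inductive Phase
  | overload
  | discharge

/-- `R.Search c k g p s t n x y`: the overload-discharge search along the Euler tour, when it is
in the loop `p` with current path `[s, t]`, outputs the path `[x, y]` after `n` further moves.
The search is the following procedure.
* Loop `overload`: while `c([s, t]) < k - g + 1`, set `t := t⁺`.
  Then output `[s, t]` if `c([s, t]) ≤ k`, and otherwise go to the loop `discharge`.
* Loop `discharge`: while `c([s, t]) > k`, set `s := s⁺`.
  Then output `[s, t]` if `c([s, t]) ≥ k - g + 1`, and otherwise go to the loop `overload`. -/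
inductive Search [Fintype V] (R : RotationSystem T) (c : V → ℕ) (k g : ℕ) :
    Phase → T.Dart → T.Dart → ℕ → T.Dart → T.Dart → Prop
  | grow {s t x y : T.Dart} {n : ℕ}
      (hlt : (subgraphWeight c (R.tourSubtree s t) : ℤ) < (k : ℤ) - g + 1)
      (next : Search R c k g Phase.overload s (R.tourNext t) n x y) :
      Search R c k g Phase.overload s t (n + 1) x y
  | foundOverload {s t : T.Dart}
      (hge : (k : ℤ) - g + 1 ≤ subgraphWeight c (R.tourSubtree s t))
      (hle : subgraphWeight c (R.tourSubtree s t) ≤ k) :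
      Search R c k g Phase.overload s t 1 s t
  | toDischarge {s t x y : T.Dart} {n : ℕ}
      (hge : (k : ℤ) - g + 1 ≤ subgraphWeight c (R.tourSubtree s t))
      (hgt : k < subgraphWeight c (R.tourSubtree s t))
      (next : Search R c k g Phase.discharge s t n x y) :
      Search R c k g Phase.overload s t (n + 1) x y
  | shrink {s t x y : T.Dart} {n : ℕ}
      (hgt : k < subgraphWeight c (R.tourSubtree s t))
      (next : Search R c k g Phase.discharge (R.tourNext s) t n x y) :
      Search R c k g Phase.discharge s t (n + 1) x y
  | foundDischarge {s t : T.Dart}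
      (hle : subgraphWeight c (R.tourSubtree s t) ≤ k)
      (hge : (k : ℤ) - g + 1 ≤ subgraphWeight c (R.tourSubtree s t)) :
      Search R c k g Phase.discharge s t 1 s t
  | toOverload {s t x y : T.Dart} {n : ℕ}
      (hle : subgraphWeight c (R.tourSubtree s t) ≤ k)
      (hlt : (subgraphWeight c (R.tourSubtree s t) : ℤ) < (k : ℤ) - g + 1)
      (next : Search R c k g Phase.overload s t n x y) :
      Search R c k g Phase.discharge s t (n + 1) x y

end RotationSystem

end SimpleGraph

/-! A random access machine with unit-cost addition, truncated subtraction, comparison and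
indirect addressing, with programs in structured form. -/
namespace RAM

/-- The memory: registers, and finitely many arrays in use by any given program. All cells hold
natural numbers. -/
structure Store where
  reg : ℕ → ℕ
  arr : ℕ → ℕ → ℕ

inductive Operand
  | lit (n : ℕ)
  | reg (r : ℕ)
  | read (a : ℕ) (i : Operand)
  | add (x y : Operand)
  | sub (x y : Operand)

/-- The value of an operand (`sub` is truncated subtraction). -/
def Operand.eval (σ : Store) : Operand → ℕ
  | lit n => n
  | reg r => σ.reg r
  | read a i => σ.arr a (i.eval σ)
  | add x y => x.eval σ + y.eval σ
  | sub x y => x.eval σ - y.eval σ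

/-- The number of unit steps for evaluating an operand. -/
def Operand.cost : Operand → ℕ
  | lit _ => 1
  | reg _ => 1
  | read _ i => i.cost + 1
  | add x y => x.cost + y.cost + 1
  | sub x y => x.cost + y.cost + 1

inductive Program
  | skip
  /-- register `r := x` -/
  | assign (r : ℕ) (x : Operand)
  /-- array cell `a[i] := x` -/
  | write (a : ℕ) (i x : Operand)
  | seq (p q : Program)
  /-- if `x < y` then `p` else `q` -/
  | ifLt (x y : Operand) (p q : Program)
  /-- while `x < y` do `p` -/
  | whileLt (x y : Operand) (p : Program)

def Store.setReg (σ : Store) (r v : ℕ) : Store :=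
  { σ with reg := Function.update σ.reg r v }

def Store.setArr (σ : Store) (a i v : ℕ) : Store :=
  { σ with arr := Function.update σ.arr a (Function.update (σ.arr a) i v) }

/-- `Exec p σ n τ`: started in the store `σ`, the program `p` halts after `n` steps in the
store `τ`. -/
inductive Exec : Program → Store → ℕ → Store → Prop
  | skip (σ : Store) : Exec Program.skip σ 1 σ
  | assign (σ : Store) (r : ℕ) (x : Operand) :
      Exec (Program.assign r x) σ (x.cost + 1) (σ.setReg r (x.eval σ))
  | write (σ : Store) (a : ℕ) (i x : Operand) :
      Exec (Program.write a i x) σ (i.cost + x.cost + 1) (σ.setArr a (i.eval σ) (x.eval σ))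
  | seq {p q : Program} {σ τ υ : Store} {m n : ℕ} (hp : Exec p σ m τ) (hq : Exec q τ n υ) :
      Exec (Program.seq p q) σ (m + n) υ
  | ifTrue {x y : Operand} {p q : Program} {σ τ : Store} {n : ℕ}
      (h : x.eval σ < y.eval σ) (hp : Exec p σ n τ) :
      Exec (Program.ifLt x y p q) σ (x.cost + y.cost + 1 + n) τ
  | ifFalse {x y : Operand} {p q : Program} {σ τ : Store} {n : ℕ}
      (h : ¬ x.eval σ < y.eval σ) (hq : Exec q σ n τ) :
      Exec (Program.ifLt x y p q) σ (x.cost + y.cost + 1 + n) τ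
  | whileTrue {x y : Operand} {p : Program} {σ τ υ : Store} {m n : ℕ}
      (h : x.eval σ < y.eval σ) (hp : Exec p σ m τ)
      (next : Exec (Program.whileLt x y p) τ n υ) :
      Exec (Program.whileLt x y p) σ (x.cost + y.cost + 1 + m + n) υ
  | whileFalse {x y : Operand} {p : Program} {σ : Store}
      (h : ¬ x.eval σ < y.eval σ) :
      Exec (Program.whileLt x y p) σ (x.cost + y.cost + 1) σ

/-- The list `ends` of pairs of vertices contains every edge of `T` exactly once (in an arbitrary
order, with the two ends of each edge in an arbitrary order). -/
def ListsEdges {V : Type*} (T : SimpleGraph V) {m : ℕ} (ends : Fin m → V × V) : Prop :=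
  Function.Injective (fun i => s((ends i).1, (ends i).2)) ∧
    Set.range (fun i => s((ends i).1, (ends i).2)) = T.edgeSet

/-- The store that holds the input: registers `0, 1, 2` hold the number `N` of vertices, `k` and
`g`; array `0` holds the weights of the vertices, numbered from `0` to `N - 1` by `num`; arrays `1`
and `2` hold the two ends of each edge of the list `ends`. All other cells are `0`. -/
def inputStore {V : Type*} {N m : ℕ} (k g : ℕ) (c : V → ℕ) (num : V ≃ Fin N)
    (ends : Fin m → V × V) : Store where
  reg
    | 0 => N
    | 1 => k
    | 2 => g
    | _ => 0
  arr
    | 0 => fun i => if h : i < N then c (num.symm ⟨i, h⟩) else 0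
    | 1 => fun i => if h : i < m then num (ends ⟨i, h⟩).1 else 0
    | 2 => fun i => if h : i < m then num (ends ⟨i, h⟩).2 else 0
    | _ => fun _ => 0

/-- The store holds, in array `3`, the indicator function of the set `S` of vertices. -/
def Outputs {V : Type*} {N : ℕ} (num : V ≃ Fin N) (σ : Store) (S : Set V) : Prop :=
  ∀ v : V, (v ∈ S → σ.arr 3 (num v) = 1) ∧ (v ∉ S → σ.arr 3 (num v) = 0)

end RAM

/-! Fix an Euler tour, with `M = 2 * N₁ - 2` positions per period, and let `F a` be the first
position at which the path from `a` weighs at least `k - g + 1`. The core is `exists_good_window`: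
some path `[a, F a]` weighs at most `k`. Suppose that all of them weigh more. Call a dart heavy if
its branch (the part of the tree beyond its edge) together with its tail weighs more than `k`, and
let `Λ` be the set of heavy darts.

While `a` runs through a period, the weight of `[a, F a]` returns to its initial value. Where `F`
stays, this weight does not grow, and it drops by at least 1 if the dart at `a` is heavy, because
the tour comes back to that vertex only after `F a`. Where `F` jumps, the new end is a vertex new to
the path, and its previous visit left by a heavy dart. With `Φ ⊆ Λ` the set of darts obtained from
jumps and `B p` the weight of the branch of `p`, this gives `|Λ| ≤ ∑ p ∈ Φ, (min (k - g) (B p) + c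
p.fst - k)`.

If no vertex is the tail of two heavy darts (`false_of_injOn_heavy`), let `U` be the set of vertices
without heavy darts. The inequality yields `h + 2g - 2 ≤ 2|U| - c(U) ≤ |U|`. For `|U| ≤ 1` this
contradicts `g + h > 2`. For `|U| ≥ 2`, two paths of weight at most `k - g` cover the tree and both
contain `U`, so `N₂ + c(U) ≤ 2(k - g)`, against the lower bound on `N₂`.

If `v` is the tail of two heavy darts (`false_of_two_heavy`), root the tree at `v`. All `N₁ - 1`
darts towards `v` are heavy, and the heavy darts away from `v` form a subtree with at least two
leaves. Estimating both kinds separately contradicts the upper bound on `N₂`.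

So every tour has an admissible path. The left pointer of the search cannot pass the start of such a
path, which bounds the number of moves (`exists_searchPath`). The program builds a rotation system
by inserting the darts into circular linked lists, and runs the search with a visit counter for each
vertex, so that every move takes constant time. -/

namespace SimpleGraph

/-! ### Branches of a tree. -/

section Branch

variable {V : Type*} {T : SimpleGraph V}

/-- The vertices on the far side of a dart: those closer to its head than to its tail. -/
def branch (p : T.Dart) : Set V :=
  {y | T.dist p.snd y < T.dist p.fst y}

theorem mem_branch {p : T.Dart} {y : V} :
    y ∈ T.branch p ↔ T.dist p.snd y < T.dist p.fst y := Iff.rfl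

theorem IsTree.dist_adj (hT : T.IsTree) {u w : V} (h : T.Adj u w) (y : V) :
    T.dist u y = T.dist w y + 1 ∨ T.dist w y = T.dist u y + 1 := by
  have := hT.dist_eq_dist_add_one_of_adj y h
  rw [dist_comm (u := y) (v := u), dist_comm (u := y) (v := w)] at this
  exact this

/-- Prefixing either edge to a geodesic gives a path from `u` to `y`, and a tree has only one such
path. -/
theorem IsTree.closer_unique (hT : T.IsTree) {u w w' y : V} (h : T.Adj u w) (h' : T.Adj u w')
    (hw : T.dist w y < T.dist u y) (hw' : T.dist w' y < T.dist u y) : w = w' := by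
  obtain ⟨p, hp⟩ := hT.connected.exists_walk_length_eq_dist w y
  obtain ⟨p', hp'⟩ := hT.connected.exists_walk_length_eq_dist w' y
  have e := hT.dist_adj h y
  have e' := hT.dist_adj h' y
  have q : (Walk.cons h p).IsPath :=
    Walk.isPath_of_length_eq_dist _ (by rw [Walk.length_cons]; omega)
  have q' : (Walk.cons h' p').IsPath :=
    Walk.isPath_of_length_eq_dist _ (by rw [Walk.length_cons]; omega)
  have := congrArg Subtype.val ((hT.isAcyclic.subsingleton_path _ _).elim ⟨_, q⟩ ⟨_, q'⟩)
  simp only [Walk.cons.injEq] at this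
  exact this.1

theorem IsTree.exists_closer (hT : T.IsTree) {u y : V} (h : u ≠ y) :
    ∃ w, T.Adj u w ∧ T.dist w y < T.dist u y := by
  obtain ⟨p, hp⟩ := hT.connected.exists_walk_length_eq_dist u y
  cases p with
  | nil => exact absurd rfl h
  | cons ha p =>
    refine ⟨_, ha, ?_⟩
    have := dist_le p
    rw [Walk.length_cons] at hp
    omega

theorem snd_mem_branch (p : T.Dart) : p.snd ∈ T.branch p := by
  have := dist_eq_one_iff_adj.2 p.adj
  rw [mem_branch, dist_self, this]
  exact one_pos

theorem fst_notMem_branch (p : T.Dart) : p.fst ∉ T.branch p := by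
  simp [mem_branch]

theorem IsTree.mem_branch_symm (hT : T.IsTree) {p : T.Dart} {y : V} :
    y ∈ T.branch p.symm ↔ y ∉ T.branch p := by
  have := hT.dist_adj p.adj y
  simp only [mem_branch, Dart.symm, Prod.fst_swap, Prod.snd_swap]
  constructor <;> intro h <;> omega

theorem IsTree.exists_mem_branch (hT : T.IsTree) {u y : V} (h : y ≠ u) :
    ∃ q : T.Dart, q.fst = u ∧ y ∈ T.branch q := by
  obtain ⟨w, hw, hd⟩ := hT.exists_closer h.symm
  exact ⟨⟨(u, w), hw⟩, rfl, hd⟩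

theorem IsTree.branch_unique (hT : T.IsTree) {p q : T.Dart} (h : p.fst = q.fst) {y : V}
    (hp : y ∈ T.branch p) (hq : y ∈ T.branch q) : p = q := by
  obtain ⟨⟨u, w⟩, hw⟩ := p
  obtain ⟨⟨u', w'⟩, hw'⟩ := q
  obtain rfl : u = u' := h
  obtain rfl : w = w' := hT.closer_unique hw hw' hp hq
  rfl

theorem IsTree.branch_subset (hT : T.IsTree) {p q : T.Dart} (h : q.fst = p.snd) (hq : q ≠ p.symm) :
    T.branch q ⊆ T.branch p := by
  intro y hy
  by_contra hp
  exact hq (hT.branch_unique (q := p.symm) (by simpa using h) hy (hT.mem_branch_symm.2 hp))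

/-- The tour follows this recursion; it drives the induction in `exists_iterate_eq_rot`. -/
theorem IsTree.mem_branch_iff (hT : T.IsTree) {p : T.Dart} {y : V} :
    y ∈ T.branch p ↔ y = p.snd ∨ ∃ q : T.Dart, q.fst = p.snd ∧ q ≠ p.symm ∧ y ∈ T.branch q := by
  constructor
  · intro hy
    by_cases h : y = p.snd
    · exact .inl h
    · obtain ⟨q, hq, hyq⟩ := hT.exists_mem_branch h
      refine .inr ⟨q, hq, ?_, hyq⟩
      rintro rfl
      exact hT.mem_branch_symm.1 hyq hy
  · rintro (rfl | ⟨q, hq, hne, hy⟩)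
    · exact snd_mem_branch p
    · exact hT.branch_subset hq hne hy

/-- The only edge that leaves a branch is the edge of its dart. -/
theorem IsTree.branch_boundary (hT : T.IsTree) {p : T.Dart} {y z : V} (hyz : T.Adj y z)
    (hy : y ∈ T.branch p) (hz : z ∉ T.branch p) : y = p.snd ∧ z = p.fst := by
  rw [← hT.mem_branch_symm] at hz
  simp only [mem_branch, Dart.symm, Prod.fst_swap, Prod.snd_swap] at hy hz
  have h1 := hT.dist_adj hyz p.fst
  have h2 := hT.dist_adj hyz p.snd
  have h3 := hT.dist_adj p.adj y
  have h4 := hT.dist_adj p.adj z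
  simp only [dist_comm (u := y), dist_comm (u := z)] at h1 h2
  -- Otherwise the neighbour of `y` towards the head is also closer to the tail than `y`, and so is
  -- `z`. Then `z` is this neighbour, which is nearer to the head than to the tail.
  have key : y = p.snd := by
    by_contra hne
    obtain ⟨z', hz', hd⟩ := hT.exists_closer hne
    have h5 := hT.dist_adj hz' p.snd
    have h6 := hT.dist_adj hz' p.fst
    have h7 := hT.dist_adj p.adj z'
    simp only [dist_comm (u := y), dist_comm (u := z')] at h5 h6 hd
    have : z' = z := hT.closer_unique (y := p.fst) hz' hyz
      (by simp only [dist_comm (u := y), dist_comm (u := z')]; omega)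
      (by simp only [dist_comm (u := y), dist_comm (u := z)]; omega)
    subst this
    omega
  refine ⟨key, ?_⟩
  subst key
  rw [dist_self] at h2 h3
  have : T.dist p.fst z = 0 := by omega
  exact ((hT.connected.dist_eq_zero_iff).1 this).symm

end Branch

end SimpleGraph

/-! ### The Euler tour: single cycle, returns and previous visits. -/

namespace SimpleGraph

namespace RotationSystem

variable {V : Type*} {T : SimpleGraph V} (R : T.RotationSystem)

/-- The successor map of the Euler tour, as a permutation of the darts. -/
def tourPerm : Equiv.Perm T.Dart :=
  (Function.Involutive.toPerm Dart.symm Dart.symm_involutive).trans R.rot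

theorem tourPerm_pow (n : ℕ) (d : T.Dart) : (R.tourPerm ^ n) d = R.tourNext^[n] d := by
  rw [← Equiv.Perm.iterate_eq_pow]
  rfl

theorem tourNext_fst (d : T.Dart) : (R.tourNext d).fst = d.snd := R.fst_rot d.symm

theorem iterate_rot_fst (n : ℕ) (d : T.Dart) : (R.rot^[n] d).fst = d.fst := by
  induction n with
  | zero => rfl
  | succ n ih => rw [Function.iterate_succ_apply', R.fst_rot, ih]

theorem finite_dart [Finite V] : Finite T.Dart :=
  Finite.of_injective (fun d : T.Dart => d.toProd) (Dart.toProd_injective)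

theorem minimalPeriod_rot_pos [Finite V] (d : T.Dart) : 0 < Function.minimalPeriod R.rot d := by
  have := finite_dart (T := T)
  apply Function.IsPeriodicPt.minimalPeriod_pos (orderOf_pos R.rot)
  rw [Function.IsPeriodicPt, Equiv.Perm.iterate_eq_pow, pow_orderOf_eq_one]
  rfl

theorem exists_iterate_rot [Finite V] {d d' : T.Dart} (h : d.fst = d'.fst) :
    ∃ i < Function.minimalPeriod R.rot d, R.rot^[i] d = d' := by
  have := finite_dart (T := T)
  obtain ⟨i, -, hi⟩ := (R.sameCycle d d' h).exists_pow_eq'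
  refine ⟨i % Function.minimalPeriod R.rot d, Nat.mod_lt _ (R.minimalPeriod_rot_pos d), ?_⟩
  rw [Function.iterate_mod_minimalPeriod_eq, Equiv.Perm.iterate_eq_pow, hi]

/-- Between a dart and the next one at the same vertex, the tour runs exactly through the darts
of the branch of the first one. -/
theorem exists_iterate_eq_rot [Finite V] (hT : T.IsTree) (p : T.Dart) :
    ∃ n, R.tourNext^[n + 1] p = R.rot p ∧
      ∀ d : T.Dart, (∃ i, 1 ≤ i ∧ i ≤ n ∧ R.tourNext^[i] p = d) ↔ d.fst ∈ T.branch p := by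
  induction hN : (T.branch p).ncard using Nat.strong_induction_on generalizing p with
  | _ N ih =>
  -- Having crossed the edge of `p`, the tour takes the darts at its head in rotation order, from
  -- `rot p.symm` on. `j` counts those whose branches are completed; the outer induction, applied to
  -- the strictly smaller branch of the next one, carries the tour past it.
  have step : ∀ j, j + 1 ≤ Function.minimalPeriod R.rot p.symm → ∃ n, 1 ≤ n ∧
      R.tourNext^[n] p = R.rot^[j + 1] p.symm ∧
      ∀ d : T.Dart, (∃ i, 1 ≤ i ∧ i < n ∧ R.tourNext^[i] p = d) ↔
        ∃ l, 1 ≤ l ∧ l ≤ j ∧ (d = R.rot^[l] p.symm ∨ d.fst ∈ T.branch (R.rot^[l] p.symm)) := by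
    intro j
    induction j with
    | zero =>
      intro _
      refine ⟨1, le_rfl, rfl, fun d => ⟨?_, ?_⟩⟩
      · rintro ⟨i, hi, hi', -⟩; omega
      · rintro ⟨i, hi, hi', -⟩; omega
    | succ j ihj =>
      intro hj
      obtain ⟨n, hn, he, hd⟩ := ihj (by omega)
      set q := R.rot^[j + 1] p.symm with hq
      have hqf : q.fst = p.snd := R.iterate_rot_fst _ _
      have hqne : q ≠ p.symm := fun h => by
        have hper : Function.IsPeriodicPt R.rot (j + 1) p.symm := h
        have := hper.minimalPeriod_le (Nat.succ_pos j)
        omega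
      have hlt : (T.branch q).ncard < N := by
        rw [← hN]
        refine Set.ncard_lt_ncard (Set.ssubset_iff_subset_ne.2
          ⟨hT.branch_subset hqf hqne, fun h => ?_⟩) (Set.toFinite _)
        apply fst_notMem_branch q
        rw [h, hqf]
        exact snd_mem_branch p
      obtain ⟨n', he', hd'⟩ := ih _ hlt q rfl
      refine ⟨n + (n' + 1), by omega, ?_, fun d => ⟨?_, ?_⟩⟩
      · rw [add_comm, Function.iterate_add_apply, he, he', hq, ← Function.iterate_succ_apply' R.rot]
      · rintro ⟨i, hi, hi', rfl⟩
        rcases lt_trichotomy i n with h | h | h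
        · obtain ⟨l, hl, hl', h⟩ := (hd _).1 ⟨i, hi, h, rfl⟩
          exact ⟨l, hl, by omega, h⟩
        · exact ⟨j + 1, by omega, le_rfl, .inl (by rw [h, he])⟩
        · obtain ⟨m, rfl⟩ := Nat.exists_eq_add_of_lt h
          refine ⟨j + 1, by omega, le_rfl, .inr ((hd' _).1 ⟨m + 1, by omega, by omega, ?_⟩)⟩
          rw [show n + m + 1 = (m + 1) + n by omega, Function.iterate_add_apply _ (m + 1) n, he]
      · rintro ⟨l, hl, hl', h⟩
        rcases Nat.lt_or_ge j l with hjl | hjl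
        · obtain rfl : l = j + 1 := by omega
          rcases h with rfl | h
          · exact ⟨n, hn, by omega, he⟩
          · obtain ⟨i, hi, hi', rfl⟩ := (hd' _).2 h
            exact ⟨i + n, by omega, by omega, by rw [Function.iterate_add_apply, he]⟩
        · obtain ⟨i, hi, hi', h⟩ := (hd d).2 ⟨l, hl, hjl, h⟩
          exact ⟨i, hi, by omega, h⟩
  have hpos := R.minimalPeriod_rot_pos p.symm
  obtain ⟨n, hn, he, hd⟩ := step (Function.minimalPeriod R.rot p.symm - 1) (by omega)
  rw [Nat.sub_add_cancel hpos] at he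
  -- A full turn at the head ends with `p.symm`, whose successor in the tour is `rot p`.
  have he : R.tourNext^[n] p = p.symm := he.trans Function.iterate_minimalPeriod
  refine ⟨n, ?_, fun d => ⟨?_, fun h => ?_⟩⟩
  · rw [Function.iterate_succ_apply', he, tourNext, Dart.symm_symm]
  · rintro ⟨i, hi, hi', rfl⟩
    rcases hi'.lt_or_eq with h | rfl
    · obtain ⟨l, hl, hl', h⟩ := (hd _).1 ⟨i, hi, h, rfl⟩
      rcases h with h | h
      · rw [h, R.iterate_rot_fst]
        exact snd_mem_branch p
      · refine hT.branch_subset (R.iterate_rot_fst _ _) (fun h' => ?_) h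
        have hper : Function.IsPeriodicPt R.rot l p.symm := h'
        have := hper.minimalPeriod_le hl
        omega
    · rw [he]
      exact snd_mem_branch p
  · have key : ∀ q : T.Dart, q.fst = p.snd → q ≠ p.symm →
        ∃ l, 1 ≤ l ∧ l ≤ Function.minimalPeriod R.rot p.symm - 1 ∧ R.rot^[l] p.symm = q := by
      intro q hq hne
      obtain ⟨l, hl, hlq⟩ := R.exists_iterate_rot (d := p.symm) (d' := q) hq.symm
      refine ⟨l, Nat.one_le_iff_ne_zero.2 ?_, by omega, hlq⟩
      rintro rfl
      exact hne hlq.symm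
    by_cases hds : d = p.symm
    · exact ⟨n, hn, le_rfl, he.trans hds.symm⟩
    rcases hT.mem_branch_iff.1 h with h | ⟨q, hq, hne, h⟩
    · obtain ⟨l, hl, hl', rfl⟩ := key d h hds
      obtain ⟨i, hi, hi', h⟩ := (hd _).2 ⟨l, hl, hl', .inl rfl⟩
      exact ⟨i, hi, hi'.le, h⟩
    · obtain ⟨l, hl, hl', rfl⟩ := key q hq hne
      obtain ⟨i, hi, hi', h⟩ := (hd _).2 ⟨l, hl, hl', .inr h⟩
      exact ⟨i, hi, hi'.le, h⟩

/-- The tour passes all darts at the tail of `d` in rotation order, and any other dart has its tail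
in the branch of one of these. -/
theorem exists_iterate_tourNext [Finite V] (hT : T.IsTree) (d d' : T.Dart) :
    ∃ i, R.tourNext^[i] d = d' := by
  have hrot : ∀ j, ∃ i, R.tourNext^[i] d = R.rot^[j] d := by
    intro j
    induction j with
    | zero => exact ⟨0, rfl⟩
    | succ j ih =>
      obtain ⟨i, hi⟩ := ih
      obtain ⟨n, hn, -⟩ := R.exists_iterate_eq_rot hT (R.rot^[j] d)
      exact ⟨n + 1 + i, by rw [Function.iterate_add_apply, hi, hn, Function.iterate_succ_apply']⟩
  by_cases h : d'.fst = d.fst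
  · obtain ⟨j, -, rfl⟩ := R.exists_iterate_rot h.symm
    exact hrot j
  · obtain ⟨q, hq, hd⟩ := hT.exists_mem_branch h
    obtain ⟨j, -, rfl⟩ := R.exists_iterate_rot hq.symm
    obtain ⟨i, hi⟩ := hrot j
    obtain ⟨n, -, hn⟩ := R.exists_iterate_eq_rot hT (R.rot^[j] d)
    obtain ⟨l, -, -, hl⟩ := (hn d').2 hd
    exact ⟨l + i, by rw [Function.iterate_add_apply, hi, hl]⟩

/-- As the tour is a single cycle, natural numbers can serve as positions, and the darts are their
residues. -/
theorem iterate_tourNext_eq_iff [Finite V] (hT : T.IsTree) (d : T.Dart) (a b : ℕ) :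
    R.tourNext^[a] d = R.tourNext^[b] d ↔ a ≡ b [MOD Nat.card T.Dart] := by
  have := finite_dart (T := T)
  have := Fintype.ofFinite T.Dart
  have hc : R.tourPerm.IsCycleOn (Finset.univ : Finset T.Dart) := by
    refine ⟨by simp, fun x _ y _ => ?_⟩
    obtain ⟨i, hi⟩ := R.exists_iterate_tourNext hT x y
    exact ⟨i, by rw [zpow_natCast, tourPerm_pow, hi]⟩
  rw [Nat.card_eq_fintype_card, ← R.tourPerm_pow, ← R.tourPerm_pow]
  exact hc.pow_apply_eq_pow_apply (Finset.mem_univ d)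

/-- The vertex at position `a` of the Euler tour that starts with `d`. -/
def tourVertex (d : T.Dart) (a : ℕ) : V := (R.tourNext^[a] d).fst

theorem tourVertex_adj (d : T.Dart) (a : ℕ) :
    T.Adj (R.tourVertex d a) (R.tourVertex d (a + 1)) := by
  rw [tourVertex, tourVertex, Function.iterate_succ_apply', tourNext_fst]
  exact Dart.adj _

theorem iterate_add_card [Finite V] (hT : T.IsTree) (d : T.Dart) (a : ℕ) :
    R.tourNext^[a + Nat.card T.Dart] d = R.tourNext^[a] d := by
  rw [R.iterate_tourNext_eq_iff hT]
  simp [Nat.ModEq]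

theorem tourVertex_add_card [Finite V] (hT : T.IsTree) (d : T.Dart) (a : ℕ) :
    R.tourVertex d (a + Nat.card T.Dart) = R.tourVertex d a := by
  rw [tourVertex, R.iterate_add_card hT, tourVertex]

theorem exists_iterate_eq_of_lt [Finite V] (hT : T.IsTree) (d d' : T.Dart) (A : ℕ) :
    ∃ a, A ≤ a ∧ a < A + Nat.card T.Dart ∧ R.tourNext^[a] d = d' := by
  have := finite_dart (T := T)
  have : Nonempty T.Dart := ⟨d⟩
  have hpos : 0 < Nat.card T.Dart := Nat.card_pos
  obtain ⟨i, rfl⟩ := R.exists_iterate_tourNext hT (R.tourNext^[A] d) d'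
  refine ⟨i % Nat.card T.Dart + A, by omega, ?_, ?_⟩
  · have := Nat.mod_lt i hpos
    omega
  · rw [Function.iterate_add_apply, R.iterate_tourNext_eq_iff hT]
    exact Nat.mod_modEq _ _

/-- The first return of the tour to the vertex at position `a`. -/
theorem exists_return [Finite V] (hT : T.IsTree) (d : T.Dart) (a : ℕ) :
    ∃ b, a < b ∧ b ≤ a + Nat.card T.Dart ∧ R.tourNext^[b] d = R.rot (R.tourNext^[a] d) ∧
      (∀ i, a < i → i < b → R.tourVertex d i ∈ T.branch (R.tourNext^[a] d)) ∧
      ∀ v ∈ T.branch (R.tourNext^[a] d), ∃ i, a < i ∧ i < b ∧ R.tourVertex d i = v := by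
  obtain ⟨n, hn, hd⟩ := R.exists_iterate_eq_rot hT (R.tourNext^[a] d)
  have hmem : ∀ i, a < i → i < n + 1 + a → R.tourVertex d i ∈ T.branch (R.tourNext^[a] d) := by
    intro i hi hi'
    refine (hd _).1 ⟨i - a, by omega, by omega, ?_⟩
    rw [← Function.iterate_add_apply, Nat.sub_add_cancel hi.le]
  refine ⟨n + 1 + a, by omega, ?_, by rw [Function.iterate_add_apply, hn], hmem, ?_⟩
  · have := finite_dart (T := T)
    have : Nonempty T.Dart := ⟨d⟩
    have hpos : 0 < Nat.card T.Dart := Nat.card_pos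
    -- A later return would put position `a + Nat.card T.Dart`, where the tail is visited again,
    -- into the branch.
    by_contra h
    have := hmem (a + Nat.card T.Dart) (by omega) (by omega)
    rw [R.tourVertex_add_card hT] at this
    exact fst_notMem_branch _ this
  · intro v hv
    obtain ⟨w, hw, -⟩ := hT.exists_closer (u := v) (y := (R.tourNext^[a] d).fst)
      (fun h => fst_notMem_branch _ (h ▸ hv))
    obtain ⟨i, hi, hi', h⟩ := (hd ⟨(v, w), hw⟩).2 hv
    refine ⟨i + a, by omega, by omega, ?_⟩
    rw [tourVertex, Function.iterate_add_apply, h]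

/-- The last visit of the tour to the vertex at position `t`, before `t`. -/
theorem exists_previous [Finite V] (hT : T.IsTree) (d : T.Dart) (t : ℕ)
    (ht : Nat.card T.Dart ≤ t) :
    ∃ a, a < t ∧ t ≤ a + Nat.card T.Dart ∧ R.tourNext^[t] d = R.rot (R.tourNext^[a] d) ∧
      (∀ i, a < i → i < t → R.tourVertex d i ∈ T.branch (R.tourNext^[a] d)) ∧
      ∀ v ∈ T.branch (R.tourNext^[a] d), ∃ i, a < i ∧ i < t ∧ R.tourVertex d i = v := by
  -- The dart that precedes the one at `t` in the rotation occurs in the period before `t`. Its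
  -- first return is congruent to `t` and less than a period away from `t`, so it is `t`.
  obtain ⟨a, ha, ha', hd⟩ :=
    R.exists_iterate_eq_of_lt hT d (R.rot.symm (R.tourNext^[t] d)) (t - Nat.card T.Dart)
  obtain ⟨b, hb, hb', he, h1, h2⟩ := R.exists_return hT d a
  have hbt : R.tourNext^[b] d = R.tourNext^[t] d := by
    rw [he, hd, Equiv.apply_symm_apply]
  rw [R.iterate_tourNext_eq_iff hT] at hbt
  have : b = t := by
    by_contra hne
    have h3 : (Nat.card T.Dart : ℤ) ∣ (t : ℤ) - b := by
      simpa using (Nat.modEq_iff_dvd.1 hbt)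
    obtain ⟨z, hz⟩ := h3
    rcases lt_trichotomy z 0 with hz0 | rfl | hz0
    · have : (Nat.card T.Dart : ℤ) * z ≤ - Nat.card T.Dart := by nlinarith
      have hba : b = t + (b - t) := by omega
      omega
    · simp at hz; omega
    · have : (Nat.card T.Dart : ℤ) ≤ (Nat.card T.Dart : ℤ) * z := by nlinarith
      omega
  subst this
  exact ⟨a, hb, hb', he, h1, h2⟩

end RotationSystem

end SimpleGraph

/-! ### The two counting contradictions. -/

namespace SimpleGraph

section BranchWeight

variable {V : Type*} [Fintype V] {T : SimpleGraph V}

open Classical in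
/-- The vertices of a branch, as a finite set. -/
noncomputable def branchFinset (p : T.Dart) : Finset V := {y | y ∈ T.branch p}

theorem mem_branchFinset {p : T.Dart} {y : V} : y ∈ branchFinset p ↔ y ∈ T.branch p := by
  simp [branchFinset]

/-- The weight of a branch. -/
noncomputable def branchWeight (c : V → ℕ) (p : T.Dart) : ℕ := ∑ v ∈ branchFinset p, c v

/-- Heaviness thus spreads backwards: a dart that can be continued by a heavy dart without turning
back is heavy. -/
theorem IsTree.branchWeight_add_le (hT : T.IsTree) (c : V → ℕ) {p q : T.Dart}
    (h : q.fst = p.snd) (hq : q ≠ p.symm) :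
    branchWeight c q + c q.fst ≤ branchWeight c p := by
  classical
  have hn : q.fst ∉ branchFinset q := fun h => fst_notMem_branch q (mem_branchFinset.1 h)
  rw [branchWeight, branchWeight, add_comm, ← Finset.sum_insert hn]
  refine Finset.sum_le_sum_of_subset (Finset.insert_subset ?_ fun y hy => ?_)
  · rw [h, mem_branchFinset]
    exact snd_mem_branch p
  · rw [mem_branchFinset] at hy ⊢
    exact hT.branch_subset h hq hy

/-- Counting contradiction for trees in which every vertex is the tail of at most one heavy dart. -/
theorem IsTree.false_of_injOn_heavy {c : V → ℕ} {k g N₁ N₂ : ℕ}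
    (hg : 0 < g) (hgh : 2 < (g : ℤ) + (2 * N₁ - N₂))
    (hlow : 2 * (k : ℤ) - 4 * g - (2 * N₁ - N₂) + 3 ≤ N₂)
    (hN₁ : Fintype.card V = N₁) (hN₂ : ∑ v, c v = N₂) (hc : ∀ v, 0 < c v)
    (Λ Φ : Finset T.Dart)
    (hinj : Set.InjOn (fun p : T.Dart => p.fst) Λ)
    (hΦΛ : Φ ⊆ Λ)
    (hcount : (Λ.card : ℤ) ≤ ∑ p ∈ Φ, ((c p.fst : ℤ) - g))
    (hΦ : 2 ≤ Φ.card)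
    (hU : ∀ U : Finset V, (∀ u, u ∈ U ↔ ∀ p ∈ Λ, p.fst ≠ u) → 2 ≤ U.card →
      (N₂ : ℤ) + ∑ u ∈ U, (c u : ℤ) ≤ 2 * (k - g)) : False := by
  classical
  set A := Λ.image (fun p : T.Dart => p.fst) with hA
  set E := Φ.image (fun p : T.Dart => p.fst) with hE
  have hAc : A.card = Λ.card := Finset.card_image_of_injOn hinj
  have hEc : E.card = Φ.card := Finset.card_image_of_injOn (hinj.mono (by exact_mod_cast hΦΛ))
  have hEA : E ⊆ A := Finset.image_subset_image hΦΛ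
  have hsum : ∑ p ∈ Φ, ((c p.fst : ℤ) - g) = ∑ v ∈ E, ((c v : ℤ) - g) := by
    rw [hE, Finset.sum_image (hinj.mono (by exact_mod_cast hΦΛ))]
  -- With `g - 1` split off each term the remaining terms are nonnegative, so the sum may be
  -- extended from `E` to `A`; the part split off is at least `2 * (g - 1)`.
  have hE1 : ∑ v ∈ E, ((c v : ℤ) - g) = ∑ v ∈ E, ((c v : ℤ) - 1) - ((g : ℤ) - 1) * E.card := by
    simp only [Finset.sum_sub_distrib, Finset.sum_const, nsmul_eq_mul]
    ring
  have hE2 : ∑ v ∈ E, ((c v : ℤ) - 1) ≤ ∑ v ∈ A, ((c v : ℤ) - 1) :=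
    Finset.sum_le_sum_of_subset_of_nonneg hEA fun v _ _ => by
      have := hc v
      omega
  have hE3 : ∑ v ∈ A, ((c v : ℤ) - 1) = ∑ v ∈ A, (c v : ℤ) - A.card := by
    simp [Finset.sum_sub_distrib]
  have hsplit : ∑ v ∈ A, (c v : ℤ) + ∑ v ∈ Aᶜ, (c v : ℤ) = N₂ := by
    rw [Finset.sum_add_sum_compl, ← hN₂]
    push_cast
    rfl
  have hcardsplit : A.card + Aᶜ.card = N₁ := by
    rw [Finset.card_add_card_compl, hN₁]
  have hUc : (Aᶜ.card : ℤ) ≤ ∑ v ∈ Aᶜ, (c v : ℤ) := by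
    have : ∑ v ∈ Aᶜ, (1 : ℤ) ≤ ∑ v ∈ Aᶜ, (c v : ℤ) :=
      Finset.sum_le_sum fun v _ => by
        have := hc v
        omega
    simpa using this
  have hgm : 2 * ((g : ℤ) - 1) ≤ ((g : ℤ) - 1) * E.card := by
    have : (2 : ℤ) ≤ E.card := by omega
    nlinarith
  -- With `w` the weight of `Aᶜ`, the counts give `2 * N₁ - N₂ + 2 * g - 2 ≤ 2 * Aᶜ.card - w ≤
  -- Aᶜ.card`. This contradicts `hgh` if `Aᶜ.card ≤ 1`; otherwise `Aᶜ.card ≤ w` and `hU` lead to a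
  -- contradiction with `hlow`.
  rcases Nat.lt_or_ge Aᶜ.card 2 with h | h
  · omega
  · have := hU Aᶜ (fun u => by simp [hA]) h
    omega

/-- Counting contradiction for trees in which some vertex is the tail of two heavy darts. -/
theorem IsTree.false_of_two_heavy (hT : T.IsTree) {c : V → ℕ} {k g N₁ N₂ : ℕ}
    (hg : 0 < g) (hup : (N₂ : ℤ) ≤ 2 * k + g + (2 * N₁ - N₂) - 2)
    (hN₁ : Fintype.card V = N₁) (hN₂ : ∑ v, c v = N₂) (hc : ∀ v, 0 < c v)
    (hck : ∀ v, c v + g ≤ k)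
    (Λ Φ : Finset T.Dart)
    (hΛ : ∀ p, p ∈ Λ ↔ k < branchWeight c p + c p.fst)
    (hΦΛ : Φ ⊆ Λ)
    (hcount : (Λ.card : ℤ) ≤
      ∑ p ∈ Φ, (min ((k : ℤ) - g) (branchWeight c p) + c p.fst - k))
    (hex : ∀ p ∈ Λ, ∃ q ∈ Φ, q.fst ∈ T.branch p)
    {v : V} {p₁ p₂ : T.Dart} (hp₁ : p₁ ∈ Λ) (hp₂ : p₂ ∈ Λ) (hv₁ : p₁.fst = v) (hv₂ : p₂.fst = v)
    (hne : p₁ ≠ p₂) : False := by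
  classical
  have hmono : ∀ {p q : T.Dart}, q.fst = p.snd → q ≠ p.symm → q ∈ Λ → p ∈ Λ := by
    intro p q h1 h2 h3
    rw [hΛ] at h3 ⊢
    have := hT.branchWeight_add_le c h1 h2
    omega
  have : Nonempty T.Dart := ⟨p₁⟩
  -- Root the tree at `v`: `up w` is the dart from `w` towards `v`, and every dart is some `up w` or
  -- the reverse of one.
  choose! up hupf hupv using fun (w : V) (hw : w ≠ v) => hT.exists_mem_branch (Ne.symm hw)
  have hup_eq : ∀ {p : T.Dart}, v ∈ T.branch p → p.fst ≠ v ∧ p = up p.fst := by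
    intro p hp
    have h1 : p.fst ≠ v := by
      rintro rfl
      exact fst_notMem_branch p hp
    exact ⟨h1, hT.branch_unique (hupf _ h1).symm hp (hupv _ h1)⟩
  have hdown_eq : ∀ {p : T.Dart}, v ∉ T.branch p → p.snd ≠ v ∧ p = (up p.snd).symm := by
    intro p hp
    obtain ⟨h1, h2⟩ := hup_eq (hT.mem_branch_symm.2 hp)
    have h3 := congrArg Dart.symm h2
    rw [Dart.symm_symm] at h3
    exact ⟨h1, h3⟩
  have hdown : ∀ x, x ≠ v → v ∉ T.branch (up x).symm := fun x hx h =>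
    hT.mem_branch_symm.1 h (hupv x hx)
  have hsnd : ∀ x, x ≠ v → (up x).symm.snd = x := fun x hx => hupf x hx
  have hdist : ∀ x, x ≠ v → T.dist (up x).snd v < T.dist x v := fun x hx => by
    have := hupv x hx
    rwa [mem_branch, hupf x hx] at this
  -- From a neighbour of `v`, the dart to `v` can be continued by `p₁` or by `p₂` without turning
  -- back; heaviness then spreads outwards.
  have htoward : ∀ n w, T.dist w v = n → w ≠ v → up w ∈ Λ := by
    intro n
    induction n using Nat.strong_induction_on with
    | _ n ih =>
      intro w hn hw
      by_cases hz : (up w).snd = v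
      · by_cases h : p₁ = (up w).symm
        · exact hmono (hv₂.trans hz.symm) (fun h' => hne (h.trans h'.symm)) hp₂
        · exact hmono (hv₁.trans hz.symm) h hp₁
      · refine hmono (hupf _ hz) (fun h => hdown w hw ?_) (ih _ (hn ▸ hdist w hw) _ rfl hz)
        rw [← h]
        exact hupv _ hz
  -- `X` holds the heads of the heavy darts pointing away from `v`, and `D` their tails. Together
  -- with `v`, the set `X` spans a subtree whose leaves (other than the root) are `X \ D`.
  set X : Finset V := {x | x ≠ v ∧ (up x).symm ∈ Λ} with hX
  have memX : ∀ x, x ∈ X ↔ x ≠ v ∧ (up x).symm ∈ Λ := by simp [hX]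
  set D : Finset V := X.image (fun x => (up x).snd) with hD
  have hdownX : ∀ {p : T.Dart}, p ∈ Λ → v ∉ T.branch p → p.snd ∈ X ∧ p.fst ∈ D := by
    intro p hp h
    obtain ⟨h1, h2⟩ := hdown_eq h
    have h3 : p.snd ∈ X := (memX _).2 ⟨h1, h2 ▸ hp⟩
    refine ⟨h3, Finset.mem_image.2 ⟨_, h3, ?_⟩⟩
    conv_rhs => rw [h2]
    rfl
  have hvb : ∀ {p : T.Dart}, p.fst = v → v ∉ T.branch p := by
    rintro p rfl
    exact fst_notMem_branch p
  have hvX : v ∉ X := fun h => ((memX v).1 h).1 rfl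
  have hvD : v ∈ D := hv₁ ▸ (hdownX hp₁ (hvb hv₁)).2
  have hDX : ∀ u ∈ D, u ≠ v → u ∈ X := by
    intro u hu huv
    obtain ⟨x, hx, rfl⟩ := Finset.mem_image.1 hu
    obtain ⟨hxv, hxΛ⟩ := (memX x).1 hx
    refine (memX _).2 ⟨huv, hmono (q := (up x).symm) (hsnd _ huv).symm (fun h => hdown x hxv ?_) hxΛ⟩
    rw [h, Dart.symm_symm]
    exact hupv _ huv
  have hpar : ∀ {x y : V}, x ≠ v → y ∈ T.branch (up x).symm → y ≠ x →
      y ≠ v ∧ (up y).snd ∈ T.branch (up x).symm := by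
    intro x y hx hy hyx
    have hyv : y ≠ v := by
      rintro rfl
      exact hdown x hx hy
    refine ⟨hyv, ?_⟩
    by_contra h
    have hadj : T.Adj y (up y).snd := by
      have := (up y).adj
      rwa [hupf y hyv] at this
    exact hyx ((hT.branch_boundary hadj hy h).1.trans (hsnd x hx))
  -- No other member of `X` lies beyond a leaf `x`: the climb from it would reach `x` through a
  -- child in `X`, so that `x ∈ D`.
  have hXB : ∀ n z, T.dist z v = n → z ∈ X → ∀ x ∈ X \ D, z ∈ T.branch (up x).symm → z = x := by
    intro n
    induction n using Nat.strong_induction_on with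
    | _ n ih =>
      intro z hn hz x hx hzx
      by_contra hne
      rw [Finset.mem_sdiff] at hx
      have hxv := ((memX x).1 hx.1).1
      obtain ⟨hzv, hpz⟩ := hpar hxv hzx hne
      have hpD : (up z).snd ∈ D := Finset.mem_image_of_mem _ hz
      have hpv : (up z).snd ≠ v := by
        intro h
        rw [h] at hpz
        exact hdown x hxv hpz
      have := ih _ (hn ▸ hdist z hzv) _ rfl (hDX _ hpD hpv) x (Finset.mem_sdiff.2 hx) hpz
      exact hx.2 (this ▸ hpD)
  have hDB : ∀ z ∈ D, ∀ x ∈ X \ D, z ∉ T.branch (up x).symm := by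
    intro z hz x hx hzx
    have hx' := Finset.mem_sdiff.1 hx
    have hxv := ((memX x).1 hx'.1).1
    by_cases hzv : z = v
    · subst hzv
      exact hdown x hxv hzx
    · exact hx'.2 (hXB _ z rfl (hDX z hz hzv) x hx hzx ▸ hz)
  have hBB : ∀ n y, T.dist y v = n → ∀ x ∈ X \ D, ∀ x' ∈ X \ D, y ∈ T.branch (up x).symm →
      y ∈ T.branch (up x').symm → x = x' := by
    intro n
    induction n using Nat.strong_induction_on with
    | _ n ih =>
      intro y hn x hx x' hx' hy hy'
      have hxX := (Finset.mem_sdiff.1 hx).1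
      have hxX' := (Finset.mem_sdiff.1 hx').1
      by_cases h : y = x
      · subst h
        exact hXB _ _ rfl hxX x' hx' hy'
      by_cases h' : y = x'
      · subst h'
        exact (hXB _ _ rfl hxX' x hx hy).symm
      · obtain ⟨hyv, h1⟩ := hpar ((memX x).1 hxX).1 hy h
        obtain ⟨-, h2⟩ := hpar ((memX x').1 hxX').1 hy' h'
        exact ih _ (hn ▸ hdist y hyv) _ rfl x hx x' hx' h1 h2
  have hdisj : ∑ x ∈ X \ D, branchWeight c (up x).symm + ∑ u ∈ D, c u ≤ N₂ := by
    have h1 : ∑ x ∈ X \ D, branchWeight c (up x).symm =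
        ∑ y ∈ (X \ D).biUnion (fun x => branchFinset (up x).symm), c y := by
      rw [Finset.sum_biUnion]
      · rfl
      · intro x hx x' hx' hne
        rw [Function.onFun, Finset.disjoint_left]
        intro y hy hy'
        exact hne (hBB _ y rfl x hx x' hx' (mem_branchFinset.1 hy) (mem_branchFinset.1 hy'))
    rw [h1, ← Finset.sum_union, ← hN₂]
    · exact Finset.sum_le_sum_of_subset (Finset.subset_univ _)
    · rw [Finset.disjoint_left]
      intro y hy hyD
      obtain ⟨x, hx, hyx⟩ := Finset.mem_biUnion.1 hy
      exact hDB y hyD x hx (mem_branchFinset.1 hyx)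
  have hΛcard : (N₁ - 1) + X.card ≤ Λ.card := by
    have h1 : (Finset.univ.erase v).image up ∪ X.image (fun x => (up x).symm) ⊆ Λ := by
      intro p hp
      rcases Finset.mem_union.1 hp with h | h
      · obtain ⟨w, hw, rfl⟩ := Finset.mem_image.1 h
        exact htoward _ w rfl (Finset.ne_of_mem_erase hw)
      · obtain ⟨x, hx, rfl⟩ := Finset.mem_image.1 h
        exact ((memX x).1 hx).2
    refine le_trans (le_of_eq ?_) (Finset.card_le_card h1)
    rw [Finset.card_union_of_disjoint, Finset.card_image_of_injOn, Finset.card_image_of_injOn,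
      Finset.card_erase_of_mem (Finset.mem_univ v), Finset.card_univ, hN₁]
    · intro x hx y hy h
      rw [← hsnd x ((memX x).1 hx).1, ← hsnd y ((memX y).1 hy).1]
      exact congrArg (fun p : T.Dart => p.snd) h
    · intro x hx y hy h
      rw [← hupf x (Finset.ne_of_mem_erase hx), ← hupf y (Finset.ne_of_mem_erase hy), h]
    · rw [Finset.disjoint_left]
      intro p hp hp'
      obtain ⟨w, hw, rfl⟩ := Finset.mem_image.1 hp
      obtain ⟨x, hx, h⟩ := Finset.mem_image.1 hp'
      exact hdown x ((memX x).1 hx).1 (h ▸ hupv w (Finset.ne_of_mem_erase hw))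
  set ch : V → ℕ := fun u => (X.filter (fun x => (up x).snd = u)).card with hch
  have hchsum : ∑ u ∈ D, ch u = X.card :=
    (Finset.card_eq_sum_card_image (fun x => (up x).snd) X).symm
  have hchsum' : ∑ u ∈ D, (ch u : ℤ) = X.card := by exact_mod_cast hchsum
  have hchc : ∑ x ∈ X, (c (up x).snd : ℤ) = ∑ u ∈ D, (ch u : ℤ) * c u := by
    rw [← Finset.sum_fiberwise_of_maps_to (s := X) (t := D) (g := fun x => (up x).snd)
      (fun x hx => Finset.mem_image_of_mem _ hx)]
    refine Finset.sum_congr rfl fun u _ => ?_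
    rw [Finset.sum_congr rfl (g := fun _ => (c u : ℤ)), Finset.sum_const, nsmul_eq_mul]
    intro x hx
    rw [(Finset.mem_filter.1 hx).2]
  -- The root has two children in `X`, by `p₁` and `p₂`; this extra child accounts for the second
  -- leaf.
  have hch1 : ∀ u ∈ D, 1 + (if u = v then 1 else 0) ≤ ch u := by
    intro u hu
    split_ifs with h
    · subst h
      have h1 := hdown_eq (hvb hv₁)
      have h2 := hdown_eq (hvb hv₂)
      have hsub : ({p₁.snd, p₂.snd} : Finset V) ⊆ X.filter (fun x => (up x).snd = u) := by
        intro x hx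
        rw [Finset.mem_insert, Finset.mem_singleton] at hx
        rw [Finset.mem_filter]
        rcases hx with rfl | rfl
        · refine ⟨(hdownX hp₁ (hvb hv₁)).1, ?_⟩
          rw [← hv₁]
          conv_rhs => rw [h1.2]
          rfl
        · refine ⟨(hdownX hp₂ (hvb hv₂)).1, ?_⟩
          rw [← hv₂]
          conv_rhs => rw [h2.2]
          rfl
      refine le_trans (le_of_eq ?_) (Finset.card_le_card hsub)
      rw [Finset.card_pair]
      intro h
      apply hne
      rw [h1.2, h2.2, h]
    · obtain ⟨x, hx, rfl⟩ := Finset.mem_image.1 hu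
      exact Finset.card_pos.2 ⟨x, Finset.mem_filter.2 ⟨hx, rfl⟩⟩
  have hite : ∀ f : ℤ, ∑ u ∈ D, (if u = v then f else 0) = f := by
    intro f
    rw [Finset.sum_ite_eq' D v (fun _ => f), if_pos hvD]
  have hXD : D.card + 1 ≤ X.card := by
    have h1 : ∑ u ∈ D, ((1 : ℤ) + (if u = v then 1 else 0)) ≤ ∑ u ∈ D, (ch u : ℤ) :=
      Finset.sum_le_sum fun u hu => by exact_mod_cast hch1 u hu
    rw [Finset.sum_add_distrib, hite, Finset.sum_const, nsmul_eq_mul, mul_one,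
      hchsum'] at h1
    omega
  -- Each vertex of `D` is paid once and `v` a second time; every further child costs at most `k -
  -- g`.
  have hparsum : ∑ x ∈ X, (c (up x).snd : ℤ) ≤
      ∑ u ∈ D, (c u : ℤ) + c v + ((X.card : ℤ) - D.card - 1) * (k - g) := by
    have h1 : ∀ u ∈ D, (ch u : ℤ) * c u ≤ c u + (if u = v then (c v : ℤ) else 0) +
        ((ch u : ℤ) - 1 - (if u = v then 1 else 0)) * (k - g) := by
      intro u hu
      have h2 := hch1 u hu
      have h3 : (c u : ℤ) ≤ k - g := by
        have := hck u
        omega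
      have h4 : (0 : ℤ) ≤ (ch u : ℤ) - 1 - (if u = v then 1 else 0) := by
        split_ifs at h2 ⊢ <;> omega
      have h5 := mul_le_mul_of_nonneg_left h3 h4
      split_ifs at h5 ⊢ with h
      · subst h
        linarith
      · linarith
    rw [hchc]
    refine (Finset.sum_le_sum h1).trans (le_of_eq ?_)
    rw [Finset.sum_add_distrib, Finset.sum_add_distrib, hite, ← Finset.sum_mul,
      Finset.sum_sub_distrib, Finset.sum_sub_distrib, hite, hchsum']
    simp
  have hDcard : (X ∩ D).card + 1 = D.card := by
    have : X ∩ D = D.erase v := by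
      ext u
      rw [Finset.mem_inter, Finset.mem_erase]
      constructor
      · rintro ⟨h1, h2⟩
        exact ⟨((memX u).1 h1).1, h2⟩
      · rintro ⟨h1, h2⟩
        exact ⟨hDX u h2 h1, h2⟩
    rw [this, Finset.card_erase_add_one hvD]
  have hXDcard : (X \ D).card + (X ∩ D).card = X.card := Finset.card_sdiff_add_card_inter X D
  set Φ₁ := Φ.filter (fun p => v ∈ T.branch p) with hΦ₁
  set Φ₂ := Φ.filter (fun p => ¬ v ∈ T.branch p) with hΦ₂
  have hΦsum := Finset.sum_filter_add_sum_filter_not Φ (fun p => v ∈ T.branch p)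
    (fun p => min ((k : ℤ) - g) (branchWeight c p) + c p.fst - k)
  have hinj₁ : Set.InjOn (fun p : T.Dart => p.fst) Φ₁ := by
    intro p hp q hq h
    exact hT.branch_unique h (Finset.mem_filter.1 hp).2 (Finset.mem_filter.1 hq).2
  have hinj₂ : Set.InjOn (fun p : T.Dart => p.snd) Φ₂ := by
    intro p hp q hq h
    rw [(hdown_eq (Finset.mem_filter.1 hp).2).2, (hdown_eq (Finset.mem_filter.1 hq).2).2]
    exact congrArg (fun x => (up x).symm) h
  -- Beyond a leaf lies the tail of a dart of `Φ`. That tail is not in `D`, so the dart points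
  -- towards `v`.
  have hΦ₁ne : 1 ≤ Φ₁.card := by
    have hne : (X \ D).Nonempty := by
      rw [← Finset.card_pos]
      omega
    obtain ⟨x, hx⟩ := hne
    have hx' := (memX x).1 (Finset.mem_sdiff.1 hx).1
    obtain ⟨q, hq, hqx⟩ := hex _ hx'.2
    refine Finset.card_pos.2 ⟨q, Finset.mem_filter.2 ⟨hq, ?_⟩⟩
    by_contra h
    exact hDB _ (hdownX (hΦΛ hq) h).2 x hx hqx
  have hsum₁ : ∑ p ∈ Φ₁, (min ((k : ℤ) - g) (branchWeight c p) + c p.fst - k) ≤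
      N₂ - c v - (N₁ - 1) - (g - 1) := by
    have h1 : ∑ p ∈ Φ₁, (min ((k : ℤ) - g) (branchWeight c p) + c p.fst - k) ≤
        ∑ p ∈ Φ₁, ((c p.fst : ℤ) - 1 - (g - 1)) :=
      Finset.sum_le_sum fun p _ => by
        have := min_le_left ((k : ℤ) - g) (branchWeight c p)
        linarith
    have h2 : ∑ p ∈ Φ₁, ((c p.fst : ℤ) - 1) ≤ ∑ u ∈ Finset.univ.erase v, ((c u : ℤ) - 1) := by
      rw [← Finset.sum_image (f := fun u => (c u : ℤ) - 1) hinj₁]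
      refine Finset.sum_le_sum_of_subset_of_nonneg ?_ fun u _ _ => by
        have := hc u
        omega
      intro u hu
      obtain ⟨p, hp, rfl⟩ := Finset.mem_image.1 hu
      exact Finset.mem_erase.2 ⟨(hup_eq (Finset.mem_filter.1 hp).2).1, Finset.mem_univ _⟩
    have hN₂' : ∑ u, (c u : ℤ) = N₂ := by exact_mod_cast hN₂
    have h3 : ∑ u ∈ Finset.univ.erase v, ((c u : ℤ) - 1) = N₂ - c v - (N₁ - 1) := by
      have := Finset.add_sum_erase Finset.univ (fun u => (c u : ℤ) - 1) (Finset.mem_univ v)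
      rw [Finset.sum_sub_distrib (s := Finset.univ), hN₂', Finset.sum_const, Finset.card_univ, hN₁,
        nsmul_eq_mul, mul_one] at this
      linarith
    have h5 : ∑ p ∈ Φ₁, ((c p.fst : ℤ) - 1 - (g - 1)) =
        ∑ p ∈ Φ₁, ((c p.fst : ℤ) - 1) - Φ₁.card * (g - 1) := by
      rw [Finset.sum_sub_distrib, Finset.sum_const, nsmul_eq_mul]
    have h4 : (1 : ℤ) * (g - 1) ≤ (Φ₁.card : ℤ) * (g - 1) :=
      mul_le_mul_of_nonneg_right (by exact_mod_cast hΦ₁ne) (by omega)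
    linarith
  have hsum₂ : ∑ p ∈ Φ₂, (min ((k : ℤ) - g) (branchWeight c p) + c p.fst - k) ≤
      ∑ x ∈ X \ D, ((branchWeight c (up x).symm : ℤ) + c (up x).snd - k) +
        ∑ x ∈ X ∩ D, ((c (up x).snd : ℤ) - 1) := by
    have h1 : ∑ p ∈ Φ₂, (min ((k : ℤ) - g) (branchWeight c p) + c p.fst - k) =
        ∑ x ∈ Φ₂.image (fun p : T.Dart => p.snd),
          (min ((k : ℤ) - g) (branchWeight c (up x).symm) + c (up x).snd - k) := by
      rw [Finset.sum_image hinj₂]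
      refine Finset.sum_congr rfl fun p hp => ?_
      have := (hdown_eq (Finset.mem_filter.1 hp).2).2
      conv_lhs => rw [this]
      rfl
    have hsub : Φ₂.image (fun p : T.Dart => p.snd) ⊆ X := by
      intro x hx
      obtain ⟨p, hp, rfl⟩ := Finset.mem_image.1 hx
      exact (hdownX (hΦΛ (Finset.mem_filter.1 hp).1) (Finset.mem_filter.1 hp).2).1
    -- These bounds use the branch weight at a leaf and `k - g ≤ k - 1` at an inner vertex. They are
    -- nonnegative, so the sum may be extended to all of `X`.
    have h2 : ∀ x ∈ X, 0 ≤ if x ∈ D then ((c (up x).snd : ℤ) - 1) else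
        ((branchWeight c (up x).symm : ℤ) + c (up x).snd - k) := by
      intro x hx
      split_ifs
      · have := hc (up x).snd
        omega
      · have := (hΛ _).1 ((memX x).1 hx).2
        change k < branchWeight c (up x).symm + c (up x).snd at this
        omega
    have h3 : ∑ x ∈ X, (if x ∈ D then ((c (up x).snd : ℤ) - 1) else
        ((branchWeight c (up x).symm : ℤ) + c (up x).snd - k)) =
        ∑ x ∈ X \ D, ((branchWeight c (up x).symm : ℤ) + c (up x).snd - k) +
        ∑ x ∈ X ∩ D, ((c (up x).snd : ℤ) - 1) := by
      rw [Finset.sum_ite, add_comm, Finset.filter_mem_eq_inter, Finset.filter_notMem_eq_sdiff]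
    rw [h1, ← h3]
    refine le_trans (Finset.sum_le_sum fun x _ => ?_)
      (Finset.sum_le_sum_of_subset_of_nonneg hsub fun x hx _ => h2 x hx)
    have := min_le_left ((k : ℤ) - g) (branchWeight c (up x).symm)
    have := min_le_right ((k : ℤ) - g) (branchWeight c (up x).symm)
    split_ifs <;> omega
  have hexp : ∑ x ∈ X \ D, ((branchWeight c (up x).symm : ℤ) + c (up x).snd - k) +
        ∑ x ∈ X ∩ D, ((c (up x).snd : ℤ) - 1) =
      ∑ x ∈ X \ D, (branchWeight c (up x).symm : ℤ) + ∑ x ∈ X, (c (up x).snd : ℤ)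
        - (X \ D).card * k - (X ∩ D).card := by
    rw [← Finset.sum_sdiff (Finset.inter_subset_left : X ∩ D ⊆ X), Finset.sdiff_inter_self_left]
    simp only [Finset.sum_sub_distrib, Finset.sum_add_distrib, Finset.sum_const, nsmul_eq_mul]
    ring
  have hdisj' : ∑ x ∈ X \ D, (branchWeight c (up x).symm : ℤ) + ∑ u ∈ D, (c u : ℤ) ≤ N₂ := by
    exact_mod_cast hdisj
  have hN₁pos : 0 < N₁ := hN₁ ▸ Fintype.card_pos_iff.2 ⟨v⟩
  -- `e` counts the children beyond one for each vertex of `D` and two for `v`; there are `e + 2`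
  -- leaves.
  obtain ⟨e, he⟩ := Nat.exists_eq_add_of_le hXD
  have he1 : ((X.card : ℤ) - D.card - 1) = e := by omega
  have he2 : ((X \ D).card : ℤ) = e + 2 := by omega
  rw [he1] at hparsum
  rw [he2] at hexp
  have heg : (0 : ℤ) ≤ e * g := by positivity
  have hD1 : 1 ≤ D.card := by omega
  -- The two occurrences of `c v` cancel, as do those of the weight of `D`. With the lower bound
  -- `hΛcard` this contradicts `hup`.
  have hfin : (Λ.card : ℤ) ≤ 2 * N₂ - N₁ + 1 - (g - 1) - e * g - 2 * k - D.card + 1 := by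
    have hDc : ((X ∩ D).card : ℤ) = D.card - 1 := by omega
    rw [hDc] at hexp
    linarith
  have : (X.card : ℤ) = D.card + 1 + e := by omega
  zify [hN₁pos] at hΛcard
  omega

end BranchWeight

end SimpleGraph

/-! ### Weights of intervals of a sequence. -/

namespace SimpleGraph

section Window

variable {V : Type*}

open Classical in
/-- The terms of a sequence with index in `[a, b]`. -/
noncomputable def window (x : ℕ → V) (a b : ℕ) : Finset V := (Finset.Icc a b).image x

theorem mem_window {x : ℕ → V} {a b : ℕ} {v : V} :
    v ∈ window x a b ↔ ∃ i, a ≤ i ∧ i ≤ b ∧ x i = v := by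
  simp [window, and_assoc]

theorem window_mono {x : ℕ → V} {a b a' b' : ℕ} (ha : a' ≤ a) (hb : b ≤ b') :
    window x a b ⊆ window x a' b' := by
  intro v hv
  obtain ⟨i, hi, hi', rfl⟩ := mem_window.1 hv
  exact mem_window.2 ⟨i, by omega, by omega, rfl⟩

/-- The total weight of the terms of a sequence with index in `[a, b]`, without repetition. -/
noncomputable def windowWeight (c : V → ℕ) (x : ℕ → V) (a b : ℕ) : ℕ := ∑ v ∈ window x a b, c v

variable (c : V → ℕ) {x : ℕ → V}

theorem windowWeight_mono {a b a' b' : ℕ} (ha : a' ≤ a) (hb : b ≤ b') :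
    windowWeight c x a b ≤ windowWeight c x a' b' :=
  Finset.sum_le_sum_of_subset (window_mono ha hb)

theorem windowWeight_self (a : ℕ) : windowWeight c x a a = c (x a) := by
  simp [windowWeight, window]

theorem window_succ_right [DecidableEq V] {a b : ℕ} (h : a ≤ b + 1) :
    window x a (b + 1) = insert (x (b + 1)) (window x a b) := by
  ext v
  rw [Finset.mem_insert, mem_window, mem_window]
  constructor
  · rintro ⟨i, hi, hi', rfl⟩
    rcases hi'.lt_or_eq with h | rfl
    · exact .inr ⟨i, hi, by omega, rfl⟩
    · exact .inl rfl
  · rintro (rfl | ⟨i, hi, hi', rfl⟩)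
    · exact ⟨_, h, le_rfl, rfl⟩
    · exact ⟨i, hi, by omega, rfl⟩

theorem window_succ_left [DecidableEq V] {a b : ℕ} (h : a ≤ b) :
    window x a b = insert (x a) (window x (a + 1) b) := by
  ext v
  rw [Finset.mem_insert, mem_window, mem_window]
  constructor
  · rintro ⟨i, hi, hi', rfl⟩
    rcases hi.lt_or_eq with h | rfl
    · exact .inr ⟨i, h, hi', rfl⟩
    · exact .inl rfl
  · rintro (rfl | ⟨i, hi, hi', rfl⟩)
    · exact ⟨_, le_rfl, h, rfl⟩
    · exact ⟨i, by omega, hi', rfl⟩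

theorem windowWeight_succ_right_of_mem {a b : ℕ} (h : x (b + 1) ∈ window x a b) :
    windowWeight c x a (b + 1) = windowWeight c x a b := by
  classical
  obtain ⟨i, hi, hi', -⟩ := mem_window.1 h
  rw [windowWeight, window_succ_right (by omega), Finset.insert_eq_of_mem h, windowWeight]

theorem windowWeight_succ_right_of_notMem {a b : ℕ} (hab : a ≤ b + 1)
    (h : x (b + 1) ∉ window x a b) :
    windowWeight c x a (b + 1) = windowWeight c x a b + c (x (b + 1)) := by
  classical
  rw [windowWeight, window_succ_right hab, Finset.sum_insert h, windowWeight, add_comm]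

theorem windowWeight_succ_left_of_mem {a b : ℕ} (h : x a ∈ window x (a + 1) b) :
    windowWeight c x a b = windowWeight c x (a + 1) b := by
  classical
  obtain ⟨i, hi, hi', -⟩ := mem_window.1 h
  rw [windowWeight, window_succ_left (by omega), Finset.insert_eq_of_mem h, windowWeight]

theorem windowWeight_succ_left_of_notMem {a b : ℕ} (hab : a ≤ b)
    (h : x a ∉ window x (a + 1) b) :
    windowWeight c x a b = windowWeight c x (a + 1) b + c (x a) := by
  classical
  rw [windowWeight, window_succ_left hab, Finset.sum_insert h, windowWeight, add_comm]

theorem windowWeight_add_period {M : ℕ} (hx : ∀ i, x (i + M) = x i) (a b : ℕ) :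
    windowWeight c x (a + M) (b + M) = windowWeight c x a b := by
  have : window x (a + M) (b + M) = window x a b := by
    ext v
    rw [mem_window, mem_window]
    constructor
    · rintro ⟨i, hi, hi', rfl⟩
      exact ⟨i - M, by omega, by omega, by rw [← hx, Nat.sub_add_cancel (by omega)]⟩
    · rintro ⟨i, hi, hi', rfl⟩
      exact ⟨i + M, by omega, by omega, hx i⟩
  rw [windowWeight, this, windowWeight]

end Window

/-! ### Existence of an admissible path on every Euler tour. -/

namespace RotationSystem

variable {V : Type*} [Fintype V] {T : SimpleGraph V} (R : T.RotationSystem)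

theorem exists_tourVertex_eq (hT : T.IsTree) (d : T.Dart) (v : V) (A : ℕ) :
    ∃ a, A ≤ a ∧ a < A + Nat.card T.Dart ∧ R.tourVertex d a = v := by
  obtain ⟨p, hp⟩ : ∃ p : T.Dart, p.fst = v := by
    by_cases h : v = d.fst
    · exact ⟨d, h.symm⟩
    · obtain ⟨w, hw, -⟩ := hT.exists_closer h
      exact ⟨⟨(v, w), hw⟩, rfl⟩
  obtain ⟨a, ha, ha', h⟩ := R.exists_iterate_eq_of_lt hT d p A
  exact ⟨a, ha, ha', by rw [tourVertex, h, hp]⟩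

theorem card_dart_pos (d : T.Dart) : 0 < Nat.card T.Dart := by
  have := finite_dart (T := T)
  have : Nonempty T.Dart := ⟨d⟩
  exact Nat.card_pos

theorem windowWeight_full (hT : T.IsTree) (d : T.Dart) (c : V → ℕ) (a b : ℕ)
    (hb : a + Nat.card T.Dart ≤ b + 1) :
    windowWeight c (R.tourVertex d) a b = ∑ v, c v := by
  rw [windowWeight]
  congr 1
  ext v
  simp only [Finset.mem_univ, iff_true]
  obtain ⟨i, hi, hi', rfl⟩ := R.exists_tourVertex_eq hT d v a
  exact mem_window.2 ⟨i, hi, by omega, rfl⟩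

/-- The weight of the tour between two consecutive visits to a vertex. -/
theorem windowWeight_of_return (d : T.Dart) (c : V → ℕ) {a b : ℕ} (hab : a < b)
    (h₁ : ∀ i, a < i → i < b → R.tourVertex d i ∈ T.branch (R.tourNext^[a] d))
    (h₂ : ∀ v ∈ T.branch (R.tourNext^[a] d), ∃ i, a < i ∧ i < b ∧ R.tourVertex d i = v) :
    windowWeight c (R.tourVertex d) a (b - 1) =
      branchWeight c (R.tourNext^[a] d) + c (R.tourVertex d a) := by
  classical
  have hw : window (R.tourVertex d) (a + 1) (b - 1) = branchFinset (R.tourNext^[a] d) := by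
    ext v
    rw [mem_window, mem_branchFinset]
    constructor
    · rintro ⟨i, hi, hi', rfl⟩
      exact h₁ i (by omega) (by omega)
    · intro hv
      obtain ⟨i, hi, hi', rfl⟩ := h₂ v hv
      exact ⟨i, by omega, by omega, rfl⟩
  rw [windowWeight_succ_left_of_notMem c (by omega), windowWeight, hw, branchWeight]
  rw [hw, mem_branchFinset]
  exact fst_notMem_branch _

/-- Two consecutive visits to a vertex around a given position of the tour. -/
theorem exists_gap (hT : T.IsTree) (d : T.Dart) (v : V) (s : ℕ) (hs : Nat.card T.Dart ≤ s) :
    ∃ a t, a ≤ s ∧ s < t ∧ R.tourVertex d a = v ∧ R.tourVertex d t = v ∧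
      (∀ i, a < i → i < t → R.tourVertex d i ∈ T.branch (R.tourNext^[a] d)) ∧
      ∀ v ∈ T.branch (R.tourNext^[a] d), ∃ i, a < i ∧ i < t ∧ R.tourVertex d i = v := by
  classical
  have hex : ∃ t, s < t ∧ R.tourVertex d t = v := by
    obtain ⟨t, ht, -, h⟩ := R.exists_tourVertex_eq hT d v (s + 1)
    exact ⟨t, ht, h⟩
  obtain ⟨a, ha, -, he, h1, h2⟩ := R.exists_previous hT d (Nat.find hex)
    (hs.trans (Nat.find_spec hex).1.le)
  have hav : R.tourVertex d a = v := by
    rw [← (Nat.find_spec hex).2, tourVertex, tourVertex, he, R.fst_rot]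
  refine ⟨a, Nat.find hex, ?_, (Nat.find_spec hex).1, hav, (Nat.find_spec hex).2, h1, h2⟩
  by_contra h
  exact Nat.find_min hex ha ⟨by omega, hav⟩

theorem exists_first_over (hT : T.IsTree) (d : T.Dart) (c : V → ℕ) {k g : ℕ} (hg : 0 < g)
    (hk : k ≤ ∑ v, c v) (a : ℕ) :
    ∃ b, a ≤ b ∧ b < a + Nat.card T.Dart ∧ k < windowWeight c (R.tourVertex d) a b + g ∧
      ∀ t, a ≤ t → t < b → windowWeight c (R.tourVertex d) a t + g ≤ k := by
  classical
  have hM := card_dart_pos d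
  have hex : ∃ b, a ≤ b ∧ k < windowWeight c (R.tourVertex d) a b + g := by
    refine ⟨a + Nat.card T.Dart - 1, by omega, ?_⟩
    rw [R.windowWeight_full hT d c a _ (by omega)]
    omega
  refine ⟨Nat.find hex, (Nat.find_spec hex).1, ?_, (Nat.find_spec hex).2, fun t ht ht' => ?_⟩
  · have : Nat.find hex ≤ a + Nat.card T.Dart - 1 := by
      refine Nat.find_min' hex ⟨by omega, ?_⟩
      rw [R.windowWeight_full hT d c a _ (by omega)]
      omega
    omega
  · by_contra h
    exact Nat.find_min hex ht' ⟨ht, by omega⟩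

/-- Some path of the Euler tour that is shortest among those of weight at least `k - g + 1` from
its start has weight at most `k`. -/
theorem exists_good_window (hT : T.IsTree) (d : T.Dart) {c : V → ℕ} {k g N₁ N₂ : ℕ}
    (hg : 0 < g) (hk : k ≤ N₂) (hgh : 2 < (g : ℤ) + (2 * N₁ - N₂))
    (hlow : 2 * (k : ℤ) - 4 * g - (2 * N₁ - N₂) + 3 ≤ N₂)
    (hup : (N₂ : ℤ) ≤ 2 * k + g + (2 * N₁ - N₂) - 2)
    (hN₁ : Fintype.card V = N₁) (hN₂ : ∑ v, c v = N₂) (hc : ∀ v, 0 < c v) (hck : ∀ v, c v ≤ k) :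
    ∃ a b, a ≤ b ∧ b < a + Nat.card T.Dart ∧
      k < windowWeight c (R.tourVertex d) a b + g ∧ windowWeight c (R.tourVertex d) a b ≤ k ∧
      ∀ t, a ≤ t → t < b → windowWeight c (R.tourVertex d) a t + g ≤ k := by
  classical
  by_contra hfail
  set M := Nat.card T.Dart with hM
  set x := R.tourVertex d with hx
  have hMpos : 0 < M := card_dart_pos d
  have hper : ∀ i, x (i + M) = x i := fun i => R.tourVertex_add_card hT d i
  choose F hF1 hF2 hF3 hF4 using R.exists_first_over hT d c hg (hN₂.symm ▸ hk)
  simp only [← hM, ← hx] at hF2 hF3 hF4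
  have hF5 : ∀ a, k < windowWeight c x a (F a) := fun a => by
    by_contra h
    exact hfail ⟨a, F a, hF1 a, hF2 a, hF3 a, by omega, hF4 a⟩
  have hFle : ∀ a t, a ≤ t → k < windowWeight c x a t + g → F a ≤ t := fun a t hat h => by
    by_contra hlt
    have := hF4 a t hat (by omega)
    omega
  -- Otherwise a single vertex would be an admissible path.
  have hcg : ∀ v, c v + g ≤ k := by
    intro v
    obtain ⟨a, -, -, ha⟩ := R.exists_tourVertex_eq hT d v 0
    obtain rfl : x a = v := ha
    by_contra h
    have h1 : F a = a := le_antisymm (hFle a a le_rfl (by rw [windowWeight_self]; omega)) (hF1 a)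
    have h2 := hF5 a
    rw [h1, windowWeight_self] at h2
    have := hck (x a)
    omega
  have hFgt : ∀ a, a < F a := by
    intro a
    refine lt_of_le_of_ne (hF1 a) fun h => ?_
    have h2 := hF5 a
    rw [← h, windowWeight_self] at h2
    have := hck (x a)
    omega
  have hFmono : Monotone F := monotone_nat_of_le_succ fun a => by
    refine hFle a _ ((Nat.le_add_right a 1).trans (hF1 _)) ?_
    have := hF5 (a + 1)
    have := windowWeight_mono c (x := x) (Nat.le_add_right a 1) (le_refl (F (a + 1)))
    omega
  have hFper : ∀ a, F (a + M) = F a + M := by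
    intro a
    apply le_antisymm
    · refine hFle _ _ (by have := hF1 a; omega) ?_
      rw [windowWeight_add_period c hper]
      have := hF5 a
      omega
    · have h1 := hF1 (a + M)
      have h2 := hF5 (a + M)
      obtain ⟨t, ht⟩ := Nat.exists_eq_add_of_le (show M ≤ F (a + M) by omega)
      rw [ht, add_comm M t, windowWeight_add_period c hper] at h2
      have := hFle a t (by omega) (by omega)
      omega
  have : Finite T.Dart := finite_dart
  have : Fintype T.Dart := Fintype.ofFinite _
  set Λ : Finset T.Dart := {p | k < branchWeight c p + c p.fst} with hΛdef
  have hΛ : ∀ p, p ∈ Λ ↔ k < branchWeight c p + c p.fst := by simp [hΛdef]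
  -- The period starts at `M`, so that previous visits still have natural positions. `pd i` is the
  -- dart by which the tour left the end of the jump at its previous visit.
  set J : Finset ℕ := {i ∈ Finset.range M | F (M + i) < F (M + i + 1)} with hJ
  set pd : ℕ → T.Dart := fun i => R.rot.symm (R.tourNext^[F (M + i + 1)] d) with hpd
  have hpdfst : ∀ i, (pd i).fst = x (F (M + i + 1)) := by
    intro i
    rw [← R.fst_rot, hpd, Equiv.apply_symm_apply]
    rfl
  have hjump : ∀ i ∈ J, pd i ∈ Λ ∧ g < c (pd i).fst ∧
      (windowWeight c x (M + i + 1) (F (M + i + 1)) : ℤ) ≤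
        min ((k : ℤ) - g) (branchWeight c (pd i)) + c (pd i).fst := by
    intro i hi
    have hi2 := (Finset.mem_filter.1 hi).2
    set a := M + i with ha
    obtain ⟨t, ht⟩ : ∃ t, F (a + 1) = t + 1 := ⟨F (a + 1) - 1, by omega⟩
    have hta : a + 1 ≤ t := by
      have := hFgt (a + 1)
      omega
    have hu := hF4 (a + 1) t hta (by omega)
    have ho := hF5 (a + 1)
    rw [ht] at ho
    -- A vertex already on the path could not raise the weight from at most `k - g` to more than
    -- `k`.
    have hnot : x (t + 1) ∉ window x (a + 1) t := fun h => by
      rw [windowWeight_succ_right_of_mem c h] at ho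
      omega
    obtain ⟨p, hp, hp', he, h1, h2⟩ := R.exists_previous hT d (t + 1) (by omega)
    have hpe : pd i = R.tourNext^[p] d := by
      rw [hpd]
      simp only [← ha]
      rw [ht, he, Equiv.symm_apply_apply]
    have hxp : x p = x (t + 1) := by
      rw [hx, tourVertex, tourVertex, he, R.fst_rot]
    have hpa : p ≤ a := by
      by_contra h
      exact hnot (mem_window.2 ⟨p, by omega, by omega, hxp⟩)
    have hw := R.windowWeight_of_return d c hp h1 h2
    rw [← hx, Nat.add_sub_cancel] at hw
    have hsub : window x (a + 1) t ⊆ branchFinset (R.tourNext^[p] d) := by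
      intro v hv
      obtain ⟨j, hj, hj', rfl⟩ := mem_window.1 hv
      exact mem_branchFinset.2 (h1 j (by omega) (by omega))
    have hB : windowWeight c x (a + 1) t ≤ branchWeight c (R.tourNext^[p] d) :=
      Finset.sum_le_sum_of_subset hsub
    -- As `p ≤ a` and `F` jumps after `a`, the path from `p` exceeds `k` by position `t`. The path
    -- `[p, t]` consists of the tail and the branch of the dart at `p`, so this dart is heavy.
    have hFp : F p ≤ t := by
      have := hFmono hpa
      omega
    have hover := (hF5 p).trans_le (windowWeight_mono c (le_refl p) hFp)
    have hfst : (pd i).fst = x (t + 1) := by rw [hpdfst, ← ha, ht]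
    rw [windowWeight_succ_right_of_notMem c (by omega) hnot] at ho
    refine ⟨?_, by rw [hfst]; omega, ?_⟩
    · rw [hΛ, hfst, hpe, ← hxp]
      omega
    · rw [hfst, ht, windowWeight_succ_right_of_notMem c (by omega) hnot, hpe]
      push_cast
      have : (windowWeight c x (a + 1) t : ℤ) ≤
          min ((k : ℤ) - g) (branchWeight c (R.tourNext^[p] d)) := le_min (by omega) (by omega)
      linarith
  have hJinj : Set.InjOn pd J := by
    -- The ends of different jumps in one period are distinct and less than a period apart.
    have key : ∀ i j, i < j → i ∈ J → j ∈ J → pd i ≠ pd j := by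
      intro i j hij hi hj h
      have hi' := Finset.mem_filter.1 hi
      have hj' := Finset.mem_filter.1 hj
      have hjM := Finset.mem_range.1 hj'.1
      have h1 := R.rot.symm.injective h
      rw [R.iterate_tourNext_eq_iff hT, ← hM, Nat.modEq_iff_dvd] at h1
      have h2 := hFmono (show M + i + 1 ≤ M + j by omega)
      have h3 := hFmono (show M + j + 1 ≤ M + M by omega)
      rw [hFper] at h3
      have h4 := hFmono (show M ≤ M + i by omega)
      have h5 := hi'.2
      have h6 := hj'.2
      have := Int.le_of_dvd (by omega) h1
      omega
    intro i hi j hj h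
    rcases lt_trichotomy i j with hij | rfl | hij
    · exact absurd h (key i j hij hi hj)
    · rfl
    · exact absurd h.symm (key j i hij hj hi)
  set Φ := J.image pd with hΦ
  have hΦΛ : Φ ⊆ Λ := by
    intro p hp
    obtain ⟨i, hi, rfl⟩ := Finset.mem_image.1 hp
    exact (hjump i hi).1
  have hcount : (Λ.card : ℤ) ≤
      ∑ p ∈ Φ, (min ((k : ℤ) - g) (branchWeight c p) + c p.fst - k) := by
    set G : ℕ → ℤ := fun i => (windowWeight c x (M + i) (F (M + i)) : ℤ) with hG
    have htel : ∑ i ∈ Finset.range M, (G i - G (i + 1)) = 0 := by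
      rw [Finset.sum_range_sub', hG]
      simp only [add_zero]
      rw [hFper, windowWeight_add_period c hper, sub_self]
    -- If `F` stays, a heavy dart loses `c (x a) ≥ 1`, since the tour is not back at `x a` by `F a`.
    -- If `F` jumps, the old weight is at least `k + 1`, which pays 1 even for a heavy dart.
    have hstep : ∀ i ∈ Finset.range M, (if R.tourNext^[M + i] d ∈ Λ then (1 : ℤ) else 0) -
        (if F (M + i) < F (M + i + 1) then G (i + 1) - k else 0) ≤ G i - G (i + 1) := by
      intro i _
      set a := M + i with ha
      have hGi : G i = (windowWeight c x a (F a) : ℤ) := rfl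
      have hGi' : G (i + 1) = (windowWeight c x (a + 1) (F (a + 1)) : ℤ) := rfl
      split_ifs with h1 h2 h2
      · have := hF5 a
        omega
      · have hFe : F (a + 1) = F a := le_antisymm (by omega) (hFmono (Nat.le_add_right a 1))
        obtain ⟨b, hab, -, he, hb1, hb2⟩ := R.exists_return hT d a
        have hw := R.windowWeight_of_return d c hab hb1 hb2
        rw [hΛ] at h1
        have hFb := hFle a (b - 1) (by omega) (by
          rw [hx, hw]
          exact Nat.lt_add_right g h1)
        have hnot : x a ∉ window x (a + 1) (F a) := by
          intro h
          obtain ⟨j, hj, hj', hja⟩ := mem_window.1 h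
          have := hb1 j (by omega) (by omega)
          rw [← hx, hja] at this
          exact fst_notMem_branch _ this
        have := windowWeight_succ_left_of_notMem c (hF1 a) hnot
        have := hc (x a)
        rw [hFe] at hGi'
        omega
      · have := hF5 a
        omega
      · have hFe : F (a + 1) = F a := le_antisymm (by omega) (hFmono (Nat.le_add_right a 1))
        have := windowWeight_mono c (x := x) (Nat.le_add_right a 1) (le_refl (F a))
        rw [hFe] at hGi'
        omega
    have hsum := Finset.sum_le_sum hstep
    rw [htel, Finset.sum_sub_distrib, ← Finset.sum_filter, ← Finset.sum_filter, ← hJ,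
      Finset.sum_const, nsmul_eq_mul, mul_one] at hsum
    have hΛle : Λ.card ≤ ((Finset.range M).filter (fun i => R.tourNext^[M + i] d ∈ Λ)).card := by
      refine le_trans (Finset.card_le_card ?_) (Finset.card_image_le (f := fun i => R.tourNext^[M + i] d))
      intro p hp
      obtain ⟨a, ha, ha', rfl⟩ := R.exists_iterate_eq_of_lt hT d p M
      refine Finset.mem_image.2 ⟨a - M, Finset.mem_filter.2 ⟨Finset.mem_range.2 (by omega), ?_⟩, ?_⟩
      · rwa [Nat.add_sub_cancel' ha]
      · simp only [Nat.add_sub_cancel' ha]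
    have hJle : ∑ i ∈ J, (G (i + 1) - k) ≤
        ∑ i ∈ J, (min ((k : ℤ) - g) (branchWeight c (pd i)) + c (pd i).fst - k) :=
      Finset.sum_le_sum fun i hi => by
        have := (hjump i hi).2.2
        have hGi' : G (i + 1) = (windowWeight c x (M + i + 1) (F (M + i + 1)) : ℤ) := rfl
        linarith
    rw [hΦ, Finset.sum_image hJinj]
    have : (Λ.card : ℤ) ≤
      (((Finset.range M).filter (fun i => R.tourNext^[M + i] d ∈ Λ)).card : ℤ) := by
      exact_mod_cast hΛle
    linarith
  -- Every value of `F` in this range is the end of a jump, namely after the first `j` with `F a ≤ F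
  -- (j + 1)`; a jump before `M` is shifted by a period.
  have hhit : ∀ a, M ≤ a → a < M + M → ∃ q ∈ Φ, q.fst = x (F a) := by
    intro a ha ha'
    have hex : ∃ j, F a ≤ F (j + 1) := ⟨a, hFmono (Nat.le_add_right a 1)⟩
    obtain ⟨j, hj1, hjmin⟩ : ∃ j, F a ≤ F (j + 1) ∧ ∀ m < j, ¬ F a ≤ F (m + 1) :=
      ⟨Nat.find hex, Nat.find_spec hex, fun m hm => Nat.find_min hex hm⟩
    have hj2 : j < a := by
      by_contra h
      apply hjmin (a - 1) (by omega)
      rw [Nat.sub_add_cancel (by omega)]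
    have hj3 : F (j + 1) = F a := le_antisymm (hFmono hj2) hj1
    have hj4 : F j < F a := by
      rcases Nat.eq_zero_or_pos j with h0 | h0
      · rw [h0]
        have h1 := hFper 0
        rw [zero_add] at h1
        have := hFmono ha
        omega
      · have := hjmin (j - 1) (by omega)
        rw [Nat.sub_add_cancel h0] at this
        omega
    rcases Nat.lt_or_ge j M with hjM | hjM
    · have h1 : F (M + j) = F j + M := by rw [add_comm M j, hFper]
      have h2 : F (M + j + 1) = F a + M := by
        rw [show M + j + 1 = j + 1 + M by omega, hFper, hj3]
      refine ⟨pd j, Finset.mem_image_of_mem _ (Finset.mem_filter.2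
        ⟨Finset.mem_range.2 hjM, by omega⟩), ?_⟩
      rw [hpdfst, h2, hper]
    · obtain ⟨i, rfl⟩ : ∃ i, j = M + i := ⟨j - M, by omega⟩
      refine ⟨pd i, Finset.mem_image_of_mem _ (Finset.mem_filter.2
        ⟨Finset.mem_range.2 (by omega), by omega⟩), ?_⟩
      rw [hpdfst, hj3]
  have hex : ∀ p ∈ Λ, ∃ q ∈ Φ, q.fst ∈ T.branch p := by
    intro p hp
    obtain ⟨a, ha, ha', rfl⟩ := R.exists_iterate_eq_of_lt hT d p M
    obtain ⟨q, hq, hqa⟩ := hhit a ha ha'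
    refine ⟨q, hq, ?_⟩
    obtain ⟨b, hab, -, he, hb1, hb2⟩ := R.exists_return hT d a
    have hw := R.windowWeight_of_return d c hab hb1 hb2
    rw [hΛ] at hp
    have hFb := hFle a (b - 1) (by omega) (by
      rw [hx, hw]
      exact Nat.lt_add_right g hp)
    rw [hqa]
    exact hb1 _ (hFgt a) (by omega)
  by_cases hinj : Set.InjOn (fun p : T.Dart => p.fst) Λ
  · have hΦ2 : 2 ≤ Φ.card := by
      obtain ⟨q, hq, -⟩ := hhit M le_rfl (by omega)
      obtain ⟨q', hq', h⟩ := hex q (hΦΛ hq)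
      refine Finset.one_lt_card.2 ⟨q, hq, q', hq', ?_⟩
      rintro rfl
      exact fst_notMem_branch _ h
    refine IsTree.false_of_injOn_heavy hg hgh hlow hN₁ hN₂ hc Λ Φ hinj hΦΛ
      (hcount.trans (Finset.sum_le_sum fun p _ => ?_)) hΦ2 ?_
    · have := min_le_left ((k : ℤ) - g) (branchWeight c p)
      linarith
    intro U hU hU2
    -- At a light dart the path between two visits weighs at most `k`, and its closing visit adds
    -- nothing. So it ends before `F a`, and `F a ≤ F s`.
    have hvisit : ∀ u ∈ U, ∀ s, M ≤ s → ∀ a t, a ≤ s → s < t → x a = u → x t = u →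
        (∀ i, a < i → i < t → R.tourVertex d i ∈ T.branch (R.tourNext^[a] d)) →
        (∀ v ∈ T.branch (R.tourNext^[a] d), ∃ i, a < i ∧ i < t ∧ R.tourVertex d i = v) →
        t < F s := by
      intro u hu s hs a t has hst hau htu h1 h2
      have hnot : R.tourNext^[a] d ∉ Λ := fun h => (hU u).1 hu _ h hau
      rw [hΛ] at hnot
      have hw := R.windowWeight_of_return d c (has.trans_lt hst) h1 h2
      have h3 : windowWeight c x a (t - 1) ≤ k := by
        rw [hx, hw]
        exact not_lt.1 hnot
      have h4 : windowWeight c x a t ≤ k := by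
        have h5 : x (t - 1 + 1) ∈ window x a (t - 1) := by
          rw [Nat.sub_add_cancel (by omega)]
          exact mem_window.2 ⟨a, le_rfl, by omega, hau.trans htu.symm⟩
        have := windowWeight_succ_right_of_mem c h5
        rw [Nat.sub_add_cancel (by omega)] at this
        omega
      have h5 := hFmono has
      by_contra hlt
      have h6 := hF5 a
      have h7 := windowWeight_mono c (x := x) (le_refl a) (show F a ≤ t by omega)
      omega
    have hUsub : ∀ s, M ≤ s → U ⊆ window x s (F s - 1) := by
      intro s hs u hu
      obtain ⟨a, t, has, hst, hau, htu, h1, h2⟩ := R.exists_gap hT d u s hs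
      have := hvisit u hu s hs a t has hst hau htu h1 h2
      exact mem_window.2 ⟨t, by omega, by omega, htu⟩
    -- Start at a visit `a` to `u` that leaves towards `v`, and let `a'` be the last visit to `v`
    -- before the return `b` to `u`. The path below `F a` contains `b`, and the one from `a'` below
    -- `F a'` will turn out to go beyond `a + M`. Together they cover a period, and both contain
    -- `U`.
    obtain ⟨u, hu, v, hv, huv⟩ := Finset.one_lt_card.1 hU2
    obtain ⟨p, hpu, hpv⟩ := hT.exists_mem_branch huv.symm
    obtain ⟨a, ha, -, rfl⟩ := R.exists_iterate_eq_of_lt hT d p M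
    obtain ⟨b, hab, hbM, he, hb1, hb2⟩ := R.exists_return hT d a
    have hxb : x b = u := by rw [hx, tourVertex, he, R.fst_rot, hpu]
    have hbF : b < F a := hvisit u hu a ha a b le_rfl hab hpu hxb hb1 hb2
    obtain ⟨i, hai, hib, hxi⟩ := hb2 v hpv
    obtain ⟨a', t', ha'b, hbt', hxa', hxt', hb1', hb2'⟩ := R.exists_gap hT d v b (by omega)
    obtain ⟨a'', t'', ha'', ht'', hxa'', hxt'', hb1'', hb2''⟩ :=
      R.exists_gap hT d v (a + M) (by omega)
    have hnov : ∀ {α τ j : ℕ}, R.tourVertex d α = v →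
        (∀ i, α < i → i < τ → R.tourVertex d i ∈ T.branch (R.tourNext^[α] d)) →
        R.tourVertex d j = v → j < τ → j ≤ α := by
      intro α τ j hα hτ hj hjτ
      by_contra h
      have := hτ j (by omega) hjτ
      rw [hj, ← hα] at this
      exact fst_notMem_branch _ this
    have hia' : i ≤ a' := hnov hxa' hb1' hxi (by omega)
    have ha'a'' : a' ≤ a'' := hnov hxa'' hb1'' hxa' (by omega)
    have ha'b' : a' < b := lt_of_le_of_ne ha'b fun h => huv (by rw [← hxb, ← h, hx, hxa'])
    have hxaM : x (a + M) = u := (hper a).trans hpu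
    have ha''M : a'' < a + M := lt_of_le_of_ne ha'' fun h => huv (by rw [← hxaM, ← h, hx, hxa''])
    -- Both visits to `v` leave by the dart towards `u`, which occurs once per period. Hence `a'` is
    -- also the last visit to `v` before `a + M`.
    have hee : R.tourNext^[a'] d = R.tourNext^[a''] d := by
      refine hT.branch_unique (y := u) (hxa'.trans hxa''.symm) ?_ ?_
      · rw [← hxb]
        exact hb1' b ha'b' hbt'
      · rw [← hxaM]
        exact hb1'' _ ha''M ht''
    have haa : a' = a'' := by
      by_contra hne
      rw [R.iterate_tourNext_eq_iff hT, ← hM, Nat.modEq_iff_dvd] at hee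
      have := Int.le_of_dvd (by omega) hee
      omega
    subst haa
    have hF' : t'' < F a' :=
      hvisit v hv a' (by omega) a' t'' le_rfl (by omega) hxa' hxt'' hb1'' hb2''
    have hcover : window x a (F a - 1) ∪ window x a' (F a' - 1) = Finset.univ := by
      ext y
      simp only [Finset.mem_union, Finset.mem_univ, iff_true]
      obtain ⟨j, hj, hj', rfl⟩ := R.exists_tourVertex_eq hT d y a
      rcases Nat.lt_or_ge j a' with h | h
      · exact .inl (mem_window.2 ⟨j, hj, by omega, rfl⟩)
      · exact .inr (mem_window.2 ⟨j, h, by omega, rfl⟩)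
    have h1 : ∑ y ∈ window x a (F a - 1) ∪ window x a' (F a' - 1), c y +
        ∑ y ∈ window x a (F a - 1) ∩ window x a' (F a' - 1), c y =
        ∑ y ∈ window x a (F a - 1), c y + ∑ y ∈ window x a' (F a' - 1), c y :=
      Finset.sum_union_inter
    rw [hcover, hN₂] at h1
    have h2 : ∑ y ∈ U, c y ≤ ∑ y ∈ window x a (F a - 1) ∩ window x a' (F a' - 1), c y :=
      Finset.sum_le_sum_of_subset (Finset.subset_inter (hUsub a ha) (hUsub a' (by omega)))
    have h3 := hF4 a (F a - 1) (by omega) (by omega)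
    have h4 := hF4 a' (F a' - 1) (by omega) (by omega)
    unfold windowWeight at h3 h4
    rw [← Nat.cast_sum]
    omega
  · simp only [Set.InjOn, not_forall] at hinj
    obtain ⟨p₁, hp₁, p₂, hp₂, h, hne⟩ := hinj
    exact hT.false_of_two_heavy hg hup hN₁ hN₂ hc hcg Λ Φ hΛ hΦΛ hcount hex hp₁ hp₂ h rfl hne

end RotationSystem

end SimpleGraph

/-! ### The overload-discharge search in terms of positions. -/

namespace SimpleGraph

/-- `SearchPath c k g M x a b n a' b'`: the two pointers of the search, at the positions `a ≤ b`
of a cyclic sequence of period `M`, reach the positions `a' ≤ b'` of an admissible window after `n`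
pointer moves. -/
inductive SearchPath {V : Type*} (c : V → ℕ) (k g M : ℕ) (x : ℕ → V) :
    ℕ → ℕ → ℕ → ℕ → ℕ → Prop
  | done {a b : ℕ} (hab : a ≤ b) (hba : b < a + M) (hge : k < windowWeight c x a b + g)
      (hle : windowWeight c x a b ≤ k) : SearchPath c k g M x a b 0 a b
  | grow {a b n a' b' : ℕ} (hab : a ≤ b) (hba : b + 1 < a + M)
      (hlt : windowWeight c x a b + g ≤ k) (next : SearchPath c k g M x a (b + 1) n a' b') :
      SearchPath c k g M x a b (n + 1) a' b'
  | shrink {a b n a' b' : ℕ} (hab : a + 1 ≤ b) (hba : b < a + M)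
      (hgt : k < windowWeight c x a b) (next : SearchPath c k g M x (a + 1) b n a' b') :
      SearchPath c k g M x a b (n + 1) a' b'

namespace RotationSystem

variable {V : Type*} {T : SimpleGraph V} (R : T.RotationSystem)

theorem exists_walk_support (d : T.Dart) {a b : ℕ} (hab : a ≤ b) :
    ∃ p : T.Walk (R.tourVertex d a) (R.tourVertex d b),
      ∀ v, v ∈ p.support ↔ v ∈ window (R.tourVertex d) a b := by
  classical
  induction b, hab using Nat.le_induction with
  | base => exact ⟨Walk.nil, fun v => by simp [window]⟩
  | succ b hab ih =>
    obtain ⟨p, hp⟩ := ih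
    refine ⟨p.concat (R.tourVertex_adj d b), fun v => ?_⟩
    rw [Walk.support_concat, List.mem_append, hp,
      window_succ_right (by omega), Finset.mem_insert, List.mem_singleton, or_comm]

variable [Fintype V]

/-- The bound on `b` matters: within one period, the dart at position `b` is not met earlier, so the
path does not stop too soon. -/
theorem tourPath_eq (hT : T.IsTree) (d : T.Dart) {a b : ℕ} (hab : a ≤ b)
    (hba : b < a + Nat.card T.Dart) :
    R.tourPath (R.tourNext^[a] d) (R.tourNext^[b] d) =
      {p | ∃ i, a ≤ i ∧ i ≤ b ∧ R.tourNext^[i] d = p} := by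
  ext p
  simp only [tourPath, Set.mem_ofPred_eq, ← Function.iterate_add_apply]
  constructor
  · rintro ⟨i, rfl, hi⟩
    refine ⟨i + a, by omega, ?_, rfl⟩
    by_contra h
    exact hi (b - a) (by omega) (by rw [Nat.sub_add_cancel hab])
  · rintro ⟨i, hai, hib, rfl⟩
    refine ⟨i - a, by rw [Nat.sub_add_cancel hai], fun j hj h => ?_⟩
    rw [R.iterate_tourNext_eq_iff hT, Nat.modEq_iff_dvd] at h
    have := Int.le_of_dvd (by omega) h
    omega

theorem tourSubtree_verts (hT : T.IsTree) (d : T.Dart) {a b : ℕ} (hab : a ≤ b)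
    (hba : b < a + Nat.card T.Dart) :
    (R.tourSubtree (R.tourNext^[a] d) (R.tourNext^[b] d)).verts =
      window (R.tourVertex d) a b := by
  ext v
  rw [Finset.mem_coe, mem_window]
  simp only [tourSubtree, R.tourPath_eq hT d hab hba, Subgraph.induce_verts, Set.mem_image,
    Set.mem_ofPred_eq]
  constructor
  · rintro ⟨p, ⟨i, hi, hi', rfl⟩, rfl⟩
    exact ⟨i, hi, hi', rfl⟩
  · rintro ⟨i, hi, hi', rfl⟩
    exact ⟨_, ⟨i, hi, hi', rfl⟩, rfl⟩

theorem subgraphWeight_tourSubtree (hT : T.IsTree) (d : T.Dart) (c : V → ℕ) {a b : ℕ}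
    (hab : a ≤ b) (hba : b < a + Nat.card T.Dart) :
    subgraphWeight c (R.tourSubtree (R.tourNext^[a] d) (R.tourNext^[b] d)) =
      windowWeight c (R.tourVertex d) a b := by
  classical
  rw [subgraphWeight, windowWeight, R.tourSubtree_verts hT d hab hba]
  congr 1
  ext v
  simp

theorem isTree_tourSubtree (hT : T.IsTree) (d : T.Dart) {a b : ℕ} (hab : a ≤ b)
    (hba : b < a + Nat.card T.Dart) :
    (R.tourSubtree (R.tourNext^[a] d) (R.tourNext^[b] d)).coe.IsTree := by
  refine ⟨?_, hT.isAcyclic.subgraph _⟩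
  obtain ⟨p, hp⟩ := R.exists_walk_support d hab
  have h := connected_induce_iff.1 p.connected_induce_support
  have hs : {v | v ∈ p.support} =
      (fun q : T.Dart => q.fst) '' R.tourPath (R.tourNext^[a] d) (R.tourNext^[b] d) := by
    have := R.tourSubtree_verts hT d hab hba
    rw [tourSubtree, Subgraph.induce_verts] at this
    rw [this]
    ext v
    exact hp v
  rw [hs] at h
  exact h.coe

theorem isSubtreeOfWeight_tourSubtree (hT : T.IsTree) (d : T.Dart) {c : V → ℕ} {k g a b : ℕ}
    (hab : a ≤ b) (hba : b < a + Nat.card T.Dart)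
    (hge : k < windowWeight c (R.tourVertex d) a b + g)
    (hle : windowWeight c (R.tourVertex d) a b ≤ k) :
    IsSubtreeOfWeight c k g (R.tourSubtree (R.tourNext^[a] d) (R.tourNext^[b] d)) := by
  refine ⟨R.isTree_tourSubtree hT d hab hba, ?_, ?_⟩ <;>
    rw [R.subgraphWeight_tourSubtree hT d c hab hba] <;> omega

end RotationSystem

variable {V : Type*} {c : V → ℕ} {k g M : ℕ} {x : ℕ → V} {a b n a' b' : ℕ}

theorem SearchPath.good (h : SearchPath c k g M x a b n a' b') :
    a' ≤ b' ∧ b' < a' + M ∧ k < windowWeight c x a' b' + g ∧ windowWeight c x a' b' ≤ k := by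
  induction h with
  | done hab hba hge hle => exact ⟨hab, hba, hge, hle⟩
  | grow _ _ _ _ ih => exact ih
  | shrink _ _ _ _ ih => exact ih

/-- Each pointer move belongs to one of the two loops. If the search is in the other loop, one
change precedes the move, hence the factor 2 and the quantification over `φ`; the final 1 is the
output. -/
theorem SearchPath.search [Fintype V] {T : SimpleGraph V} (R : T.RotationSystem) (hT : T.IsTree)
    (d : T.Dart) (h : SearchPath c k g (Nat.card T.Dart) (R.tourVertex d) a b n a' b') :
    ∀ φ, ∃ m ≤ 2 * n + 1, R.Search c k g φ (R.tourNext^[a] d) (R.tourNext^[b] d) m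
      (R.tourNext^[a'] d) (R.tourNext^[b'] d) := by
  induction h with
  | done hab hba hge hle =>
    have hw := R.subgraphWeight_tourSubtree hT d c hab hba
    rintro (_ | _)
    · exact ⟨1, by omega, .foundOverload (by omega) (by omega)⟩
    · exact ⟨1, by omega, .foundDischarge (by omega) (by omega)⟩
  | grow hab hba hlt _ ih =>
    have hw := R.subgraphWeight_tourSubtree hT d c hab (show _ < _ by omega)
    obtain ⟨m, hm, h⟩ := ih .overload
    rw [Function.iterate_succ_apply'] at h
    have h := RotationSystem.Search.grow (by omega) h
    rintro (_ | _)
    · exact ⟨_, by omega, h⟩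
    · exact ⟨_, by omega, .toOverload (by omega) (by omega) h⟩
  | shrink hab hba hgt _ ih =>
    have hw := R.subgraphWeight_tourSubtree hT d c (show _ ≤ _ by omega) hba
    obtain ⟨m, hm, h⟩ := ih .discharge
    rw [Function.iterate_succ_apply'] at h
    have h := RotationSystem.Search.shrink (by omega) h
    rintro (_ | _)
    · exact ⟨_, by omega, .toDischarge (by omega) (by omega) h⟩
    · exact ⟨_, by omega, h⟩

/-- The search reaches an admissible window, at the latest when its left pointer reaches the start
of a given one. -/
theorem exists_searchPath {N₂ : ℕ} (hg : 0 < g) (hk : k ≤ N₂) (hck : ∀ v, c v ≤ k)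
    (hfull : ∀ a, windowWeight c x a (a + M - 1) = N₂)
    {α β : ℕ} (hge : k < windowWeight c x α β + g)
    (hle : windowWeight c x α β ≤ k) (hβ : α ≤ β)
    (hab : a ≤ b) (hba : b < a + M) (haα : a ≤ α)
    (hun : ∀ t, a ≤ t → t < b → windowWeight c x a t + g ≤ k) :
    ∃ n ≤ (α - a) + (α + M - b), ∃ a' b', SearchPath c k g M x a b n a' b' := by
  induction hm : (α - a) + (α + M - b) using Nat.strong_induction_on generalizing a b with
  | _ m ih =>
  rcases Nat.lt_or_ge k (windowWeight c x a b + g) with h1 | h1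
  · rcases Nat.lt_or_ge k (windowWeight c x a b) with h2 | h2
    -- At `a = α` no overshoot occurs: `β < b` contradicts `hun`, and for `b ≤ β` the path lies
    -- inside `[α, β]`.
    · have haα' : a ≠ α := by
        rintro rfl
        rcases Nat.lt_or_ge β b with h | h
        · have := hun β hβ h
          omega
        · have := windowWeight_mono c (x := x) (le_refl a) h
          omega
      have hab' : a ≠ b := by
        rintro rfl
        rw [windowWeight_self] at h2
        have := hck (x a)
        omega
      obtain ⟨n, hn, a', b', h⟩ := ih _ (by omega) (a := a + 1) (b := b) (by omega) (by omega)
        (by omega) (fun t ht ht' => by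
          have := hun t (by omega) ht'
          have := windowWeight_mono c (x := x) (Nat.le_add_right a 1) (le_refl t)
          omega) rfl
      exact ⟨n + 1, by omega, a', b', .shrink (by omega) hba h2 h⟩
    · exact ⟨0, by omega, a, b, .done hab hba h1 h2⟩
  -- A path of a full period weighs `N₂ ≥ k` and needs no further growth.
  · have hb : b + 1 < a + M := by
      by_contra h
      have h3 := hfull a
      rw [show a + M - 1 = b by omega] at h3
      omega
    obtain ⟨n, hn, a', b', h⟩ := ih _ (by omega) (a := a) (b := b + 1) (by omega) hb haα
      (fun t ht ht' => by
        rcases Nat.lt_or_ge t b with h | h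
        · exact hun t ht h
        · obtain rfl : t = b := by omega
          exact h1) rfl
    exact ⟨n + 1, by omega, a', b', .grow hab hb h1 h⟩

namespace RotationSystem

theorem card_dart [Fintype V] {T : SimpleGraph V} (hT : T.IsTree) :
    Nat.card T.Dart + 2 = 2 * Fintype.card V := by
  classical
  have h := hT.card_edgeFinset
  rw [Nat.card_eq_fintype_card, dart_card_eq_twice_card_edges]
  omega

theorem exists_searchPath_of_tree [Fintype V] {T : SimpleGraph V} (R : T.RotationSystem)
    (hT : T.IsTree) (d : T.Dart) {N₁ N₂ : ℕ}
    (hg : 0 < g) (hk : k ≤ N₂) (hgh : 2 < (g : ℤ) + (2 * N₁ - N₂))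
    (hlow : 2 * (k : ℤ) - 4 * g - (2 * N₁ - N₂) + 3 ≤ N₂)
    (hup : (N₂ : ℤ) ≤ 2 * k + g + (2 * N₁ - N₂) - 2)
    (hN₁ : Fintype.card V = N₁) (hN₂ : ∑ v, c v = N₂) (hc : ∀ v, 0 < c v) (hck : ∀ v, c v ≤ k) :
    ∃ n ≤ 6 * N₁, ∃ a' b',
      SearchPath c k g (Nat.card T.Dart) (R.tourVertex d) 0 0 n a' b' := by
  classical
  have hM := card_dart_pos d
  have hper := fun i => R.tourVertex_add_card hT d i
  have hex : ∃ a b, a ≤ b ∧ b < a + Nat.card T.Dart ∧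
      k < windowWeight c (R.tourVertex d) a b + g ∧ windowWeight c (R.tourVertex d) a b ≤ k := by
    obtain ⟨a, b, h1, h2, h3, h4, -⟩ := R.exists_good_window hT d hg hk hgh hlow hup hN₁ hN₂ hc hck
    exact ⟨a, b, h1, h2, h3, h4⟩
  obtain ⟨α, ⟨β, hαβ, hβ, hge, hle⟩, hmin⟩ : ∃ α, (∃ b, α ≤ b ∧ b < α + Nat.card T.Dart ∧
      k < windowWeight c (R.tourVertex d) α b + g ∧ windowWeight c (R.tourVertex d) α b ≤ k) ∧
      ∀ m < α, ¬ ∃ b, m ≤ b ∧ b < m + Nat.card T.Dart ∧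
      k < windowWeight c (R.tourVertex d) m b + g ∧ windowWeight c (R.tourVertex d) m b ≤ k :=
    ⟨Nat.find hex, Nat.find_spec hex, fun m hm => Nat.find_min hex hm⟩
  -- By periodicity the least admissible start lies in the first period, so there are at most three
  -- periods of pointer moves.
  have hα : α < Nat.card T.Dart := by
    by_contra h
    obtain ⟨α, rfl⟩ := Nat.exists_eq_add_of_le' (not_lt.1 h)
    obtain ⟨β, rfl⟩ := Nat.exists_eq_add_of_le' ((not_lt.1 h).trans hαβ)
    rw [windowWeight_add_period c hper] at hge hle
    exact hmin α (by omega) ⟨β, by omega, by omega, hge, hle⟩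
  have hcard := card_dart hT
  obtain ⟨n, hn, a', b', h⟩ := exists_searchPath (M := Nat.card T.Dart) (a := 0) (b := 0) hg hk hck
    (fun a => (R.windowWeight_full hT d c a _ (by omega)).trans hN₂) hge hle hαβ le_rfl
    (by omega) (Nat.zero_le _) (fun t _ ht => absurd ht (Nat.not_lt_zero t))
  exact ⟨n, by omega, a', b', h⟩

end RotationSystem

end SimpleGraph

/-! ### The program, and rules for running times. -/

namespace RAM

theorem Store.setReg_reg (σ : Store) (r v r' : ℕ) :
    (σ.setReg r v).reg r' = if r' = r then v else σ.reg r' := by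
  simp [Store.setReg, Function.update_apply]

theorem Store.setReg_arr (σ : Store) (r v : ℕ) : (σ.setReg r v).arr = σ.arr := rfl

theorem Store.setArr_reg (σ : Store) (a i v : ℕ) : (σ.setArr a i v).reg = σ.reg := rfl

theorem Store.setArr_arr (σ : Store) (a i v a' j : ℕ) :
    (σ.setArr a i v).arr a' j = if a' = a ∧ j = i then v else σ.arr a' j := by
  by_cases h : a' = a
  · subst h
    simp [Store.setArr, Function.update_apply]
  · simp [Store.setArr, h]

theorem Store.setArr_arr_of_ne (σ : Store) {a a' : ℕ} (i v : ℕ) (h : a' ≠ a) :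
    (σ.setArr a i v).arr a' = σ.arr a' := by
  simp [Store.setArr, h]

namespace Program

/-- Programs without loops. -/
def LoopFree : Program → Prop
  | skip => True
  | assign _ _ => True
  | write _ _ _ => True
  | seq p q => p.LoopFree ∧ q.LoopFree
  | ifLt _ _ p q => p.LoopFree ∧ q.LoopFree
  | whileLt _ _ _ => False

/-- The final store of a program without loops. -/
def run : Program → Store → Store
  | skip, σ => σ
  | assign r x, σ => σ.setReg r (x.eval σ)
  | write a i x, σ => σ.setArr a (i.eval σ) (x.eval σ)
  | seq p q, σ => q.run (p.run σ)
  | ifLt x y p q, σ => if x.eval σ < y.eval σ then p.run σ else q.run σ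
  | whileLt _ _ _, σ => σ

/-- A bound for the number of steps of a program without loops. -/
def time : Program → ℕ
  | skip => 1
  | assign _ x => x.cost + 1
  | write _ i x => i.cost + x.cost + 1
  | seq p q => p.time + q.time
  | ifLt x y p q => x.cost + y.cost + 1 + (p.time + q.time)
  | whileLt _ _ _ => 0

/-- `p.Runs σ B Q`: started in `σ`, the program `p` halts within `B` steps in a store that
satisfies `Q`. -/
def Runs (p : Program) (σ : Store) (B : ℕ) (Q : Store → Prop) : Prop :=
  ∃ n τ, Exec p σ n τ ∧ n ≤ B ∧ Q τ

variable {p q : Program} {σ : Store} {B B' : ℕ} {Q Q' : Store → Prop}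

theorem LoopFree.exec (h : p.LoopFree) (σ : Store) : ∃ n ≤ p.time, Exec p σ n (p.run σ) := by
  induction p generalizing σ with
  | skip => exact ⟨1, le_rfl, .skip σ⟩
  | assign r x => exact ⟨_, le_rfl, .assign σ r x⟩
  | write a i x => exact ⟨_, le_rfl, .write σ a i x⟩
  | seq p q hp hq =>
    obtain ⟨m, hm, h1⟩ := hp h.1 σ
    obtain ⟨n, hn, h2⟩ := hq h.2 (p.run σ)
    exact ⟨m + n, Nat.add_le_add hm hn, .seq h1 h2⟩
  | ifLt x y p q hp hq =>
    rw [run, time]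
    split_ifs with hxy
    · obtain ⟨m, hm, h1⟩ := hp h.1 σ
      exact ⟨_, by omega, .ifTrue hxy h1⟩
    · obtain ⟨m, hm, h1⟩ := hq h.2 σ
      exact ⟨_, by omega, .ifFalse hxy h1⟩
  | whileLt x y p => exact h.elim

theorem LoopFree.runs (h : p.LoopFree) (hQ : Q (p.run σ)) : p.Runs σ p.time Q := by
  obtain ⟨n, hn, he⟩ := h.exec σ
  exact ⟨n, _, he, hn, hQ⟩

theorem Runs.mono (h : p.Runs σ B Q) (hB : B ≤ B') (hQ : ∀ τ, Q τ → Q' τ) : p.Runs σ B' Q' := by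
  obtain ⟨n, τ, he, hn, hq⟩ := h
  exact ⟨n, τ, he, hn.trans hB, hQ τ hq⟩

theorem Runs.seq (h : p.Runs σ B Q) (h' : ∀ τ, Q τ → q.Runs τ B' Q') :
    (Program.seq p q).Runs σ (B + B') Q' := by
  obtain ⟨n, τ, he, hn, hq⟩ := h
  obtain ⟨n', τ', he', hn', hq'⟩ := h' τ hq
  exact ⟨_, τ', .seq he he', by omega, hq'⟩

/-- A loop with an invariant that depends on the number of rounds done, out of `L`. -/
theorem runs_whileLt {x y : Operand} (I : ℕ → Store → Prop) (L : ℕ)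
    (hstep : ∀ i τ, i < L → I i τ → x.eval τ < y.eval τ ∧ p.Runs τ B (I (i + 1)))
    (hend : ∀ τ, I L τ → ¬ x.eval τ < y.eval τ) (h0 : I 0 σ) :
    (whileLt x y p).Runs σ (L * (B + (x.cost + y.cost + 1)) + (x.cost + y.cost + 1)) (I L) := by
  have key : ∀ r i τ, i + r = L → I i τ →
      (whileLt x y p).Runs τ (r * (B + (x.cost + y.cost + 1)) + (x.cost + y.cost + 1)) (I L) := by
    intro r
    induction r with
    | zero =>
      intro i τ hi h
      obtain rfl : i = L := hi
      exact ⟨_, τ, .whileFalse (hend τ h), by omega, h⟩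
    | succ r ih =>
      intro i τ hi h
      obtain ⟨hlt, n, υ, he, hn, hI⟩ := hstep i τ (by omega) h
      obtain ⟨n', ω, he', hn', hI'⟩ := ih (i + 1) υ (by omega) hI
      exact ⟨_, ω, .whileTrue hlt he he', by rw [Nat.succ_mul]; omega, hI'⟩
  exact key L 0 σ (Nat.zero_add L) h0

end Program

open Program

/-! The registers `0, 1, 2` hold the input. Register `3` is a loop counter, `4` and `5` hold the
numbers of edges and of darts, `6` and `7` the two pointers of the search, `8` the weight of the
current path, `9` a vertex and `10` tells whether the search is over. The darts are numbered; arrays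
`4`, `5`, `6` hold the tail of a dart, its reverse and its successor at its tail, array `7` holds
one plus the last dart found at a vertex, and array `8` the number of visits of the current path to
a vertex. -/

/-- Edge `j` gives the dart `j` and its reverse `j + m`, with `m` in register `4`. Every dart starts
as its own successor. -/
def initBody : Program :=
  .seq (.write 4 (.reg 3) (.read 1 (.reg 3))) <|
  .seq (.write 4 (.add (.reg 3) (.reg 4)) (.read 2 (.reg 3))) <|
  .seq (.write 5 (.reg 3) (.add (.reg 3) (.reg 4))) <|
  .seq (.write 5 (.add (.reg 3) (.reg 4)) (.reg 3)) <|
  .seq (.write 6 (.reg 3) (.reg 3)) <|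
  .seq (.write 6 (.add (.reg 3) (.reg 4)) (.add (.reg 3) (.reg 4))) <|
  .assign 3 (.add (.reg 3) (.lit 1))

/-- The current dart is inserted into the circular list at its tail, right after the last dart found
there. In array `7` the value 0 means that none was found; register `6` is only scratch space here.
-/
def linkBody : Program :=
  .seq (.assign 9 (.read 4 (.reg 3))) <|
  .seq (.ifLt (.lit 0) (.read 7 (.reg 9))
    (.seq (.assign 6 (.sub (.read 7 (.reg 9)) (.lit 1))) <|
     .seq (.write 6 (.reg 3) (.read 6 (.reg 6))) <|
     .write 6 (.reg 6) (.reg 3))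
    .skip) <|
  .seq (.write 7 (.reg 9) (.add (.reg 3) (.lit 1))) <|
  .assign 3 (.add (.reg 3) (.lit 1))

def startSearch : Program :=
  .seq (.assign 6 (.lit 0)) <|
  .seq (.assign 7 (.lit 0)) <|
  .seq (.assign 9 (.read 4 (.lit 0))) <|
  .seq (.write 8 (.reg 9) (.lit 1)) <|
  .seq (.assign 8 (.read 0 (.reg 9))) <|
  .assign 10 (.lit 0)

/-- The weight changes only when the counter of a vertex leaves 0, or reaches 0 in `shrinkBody`, so
a pointer move takes constant time. -/
def growBody : Program :=
  .seq (.assign 7 (.read 6 (.read 5 (.reg 7)))) <|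
  .seq (.assign 9 (.read 4 (.reg 7))) <|
  .seq (.ifLt (.lit 0) (.read 8 (.reg 9)) .skip
    (.assign 8 (.add (.reg 8) (.read 0 (.reg 9))))) <|
  .write 8 (.reg 9) (.add (.read 8 (.reg 9)) (.lit 1))

def shrinkBody : Program :=
  .seq (.assign 9 (.read 4 (.reg 6))) <|
  .seq (.write 8 (.reg 9) (.sub (.read 8 (.reg 9)) (.lit 1))) <|
  .seq (.ifLt (.lit 0) (.read 8 (.reg 9)) .skip
    (.assign 8 (.sub (.reg 8) (.read 0 (.reg 9))))) <|
  .assign 6 (.read 6 (.read 5 (.reg 6)))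

/-- Both loops are merged: each round makes one pointer move or stops. The lower bound is compared
as `w + g < k + 1`, without subtraction. -/
def searchBody : Program :=
  .ifLt (.add (.reg 8) (.reg 2)) (.add (.reg 1) (.lit 1)) growBody <|
  .ifLt (.reg 1) (.reg 8) shrinkBody (.assign 10 (.lit 1))

def outputBody : Program :=
  .seq (.ifLt (.lit 0) (.read 8 (.reg 3)) (.write 3 (.reg 3) (.lit 1)) .skip) <|
  .assign 3 (.add (.reg 3) (.lit 1))

/-- The program that finds a subtree of the desired weight. -/
def treeProgram : Program :=
  .ifLt (.reg 0) (.lit 2) (.write 3 (.lit 0) (.lit 1)) <|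
  .seq (.seq (.assign 4 (.sub (.reg 0) (.lit 1))) (.assign 5 (.add (.reg 4) (.reg 4)))) <|
  .seq (.whileLt (.reg 3) (.reg 4) initBody) <|
  .seq (.assign 3 (.lit 0)) <|
  .seq (.whileLt (.reg 3) (.reg 5) linkBody) <|
  .seq startSearch <|
  .seq (.whileLt (.reg 10) (.lit 1) searchBody) <|
  .seq (.assign 3 (.lit 0)) <|
  .whileLt (.reg 3) (.reg 0) outputBody

theorem runs_init {σ : Store} {m : ℕ} (h3 : σ.reg 3 = 0) (h4 : σ.reg 4 = m) :
    (whileLt (.reg 3) (.reg 4) initBody).Runs σ (m * 100 + 3) fun τ =>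
      (∀ r, r ≠ 3 → τ.reg r = σ.reg r) ∧
      (∀ a, a ≠ 4 → a ≠ 5 → a ≠ 6 → τ.arr a = σ.arr a) ∧
      ∀ j < m, τ.arr 4 j = σ.arr 1 j ∧ τ.arr 4 (j + m) = σ.arr 2 j ∧ τ.arr 5 j = j + m ∧
        τ.arr 5 (j + m) = j ∧ τ.arr 6 j = j ∧ τ.arr 6 (j + m) = j + m := by
  refine (runs_whileLt (B := initBody.time) (I := fun i τ => τ.reg 3 = i ∧
      (∀ r, r ≠ 3 → τ.reg r = σ.reg r) ∧
      (∀ a, a ≠ 4 → a ≠ 5 → a ≠ 6 → τ.arr a = σ.arr a) ∧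
      ∀ j < i, τ.arr 4 j = σ.arr 1 j ∧ τ.arr 4 (j + m) = σ.arr 2 j ∧ τ.arr 5 j = j + m ∧
        τ.arr 5 (j + m) = j ∧ τ.arr 6 j = j ∧ τ.arr 6 (j + m) = j + m) m ?_ ?_ ?_).mono ?_ ?_
  · rintro i τ hi ⟨hi3, hr, ha, hj⟩
    have h4' : τ.reg 4 = m := (hr 4 (by decide)).trans h4
    refine ⟨by simpa [Operand.eval, hi3, h4'] using hi, LoopFree.runs (by simp [initBody, LoopFree]) ?_⟩
    have h1 := congrFun (ha 1 (by decide) (by decide) (by decide)) i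
    have h2 := congrFun (ha 2 (by decide) (by decide) (by decide)) i
    simp only [initBody, run, Operand.eval, Store.setReg_reg, Store.setArr_reg, Store.setReg_arr,
      Store.setArr_arr, hi3, h4', h1, h2]
    refine ⟨by simp, fun r hr3 => by simp [hr3, hr], fun a h4 h5 h6 => ?_, fun j hji => ?_⟩
    · simp [Store.setArr_arr_of_ne, h4, h5, h6, ha]
    · rcases Nat.lt_succ_iff_lt_or_eq.1 hji with hlt | rfl
      · obtain ⟨e1, e2, e3, e4, e5, e6⟩ := hj j hlt
        have n1 : j ≠ i := by omega
        have n2 : j ≠ i + m := by omega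
        have n3 : j + m ≠ i := by omega
        simp [e1, e2, e3, e4, e5, e6, n1, n2, n3]
      · have n3 : m ≠ 0 := by omega
        simp_all
  · rintro τ ⟨hi3, hr, -⟩
    have h4' : τ.reg 4 = m := (hr 4 (by decide)).trans h4
    simp [Operand.eval, hi3, h4']
  · exact ⟨h3, fun _ _ => rfl, fun _ _ _ _ => rfl, fun j hj => absurd hj (Nat.not_lt_zero j)⟩
  · have : initBody.time ≤ 97 := by decide
    simp only [Operand.cost]
    nlinarith
  · rintro τ ⟨-, h1, h2, h3⟩
    exact ⟨h1, h2, h3⟩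

end RAM

/-! ### Building a rotation system by insertion into cycles. -/

theorem Equiv.Perm.sameCycle_mul_swap {α : Type*} [Finite α] [DecidableEq α] {f : Equiv.Perm α}
    {a b : α} (hb : f b = b) :
    (f * Equiv.swap a b).SameCycle a b ∧
      ∀ x y, f.SameCycle x y → (f * Equiv.swap a b).SameCycle x y := by
  -- The swap splices the fixed point `b` into the cycle of `a`, directly after `a`.
  have ha' : (f * Equiv.swap a b) a = b := by rw [Equiv.Perm.mul_apply, Equiv.swap_apply_left, hb]
  have hb' : (f * Equiv.swap a b) b = f a := by rw [Equiv.Perm.mul_apply, Equiv.swap_apply_right]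
  have hab' : (f * Equiv.swap a b).SameCycle a b := ⟨1, by rw [zpow_one, ha']⟩
  have step : ∀ x, (f * Equiv.swap a b).SameCycle x (f x) := by
    intro x
    by_cases hxb : x = b
    · rw [hxb, hb]
    by_cases hxa : x = a
    · rw [hxa]
      exact hab'.trans ⟨1, by rw [zpow_one, hb']⟩
    · exact ⟨1, by rw [zpow_one, Equiv.Perm.mul_apply, Equiv.swap_apply_of_ne_of_ne hxa hxb]⟩
  refine ⟨hab', fun x y hxy => ?_⟩
  obtain ⟨n, rfl⟩ := hxy.exists_nat_pow_eq
  clear hxy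
  induction n with
  | zero => exact .refl _ _
  | succ n ih =>
    rw [pow_succ', Equiv.Perm.mul_apply]
    exact ih.trans (step _)

namespace RAM

open Program

/-- `D` numbers the darts of `T` by `0, …, M - 1`. -/
structure IsDartNumbering {V : Type*} {T : SimpleGraph V} (M : ℕ) (D : ℕ → T.Dart) : Prop where
  inj : ∀ i < M, ∀ j < M, D i = D j → i = j
  surj : ∀ d, ∃ i < M, D i = d

theorem runs_link {V : Type*} [Finite V] {T : SimpleGraph V} {M N : ℕ} {D : ℕ → T.Dart}
    (hD : IsDartNumbering M D) (num : V ≃ Fin N) {σ : Store} (h3 : σ.reg 3 = 0) (h5 : σ.reg 5 = M)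
    (h4 : ∀ j < M, σ.arr 4 j = num (D j).fst) (h6 : ∀ j < M, σ.arr 6 j = j)
    (h7 : ∀ j, σ.arr 7 j = 0) :
    (whileLt (.reg 3) (.reg 5) linkBody).Runs σ (M * 100 + 3) fun τ =>
      (∀ r, r ≠ 3 → r ≠ 6 → r ≠ 9 → τ.reg r = σ.reg r) ∧
      (∀ a, a ≠ 6 → a ≠ 7 → τ.arr a = σ.arr a) ∧
      ∃ R : T.RotationSystem, ∀ j < M, τ.arr 6 j < M ∧ D (τ.arr 6 j) = R.rot (D j) := by
  classical
  have : Finite T.Dart := SimpleGraph.RotationSystem.finite_dart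
  -- Invariant: array `6` stores a permutation `f` that fixes the darts not yet treated and has all
  -- treated darts with a common tail on one cycle.
  refine (runs_whileLt (B := linkBody.time) (I := fun i τ => τ.reg 3 = i ∧
      (∀ r, r ≠ 3 → r ≠ 6 → r ≠ 9 → τ.reg r = σ.reg r) ∧
      (∀ a, a ≠ 6 → a ≠ 7 → τ.arr a = σ.arr a) ∧
      ∃ f : Equiv.Perm T.Dart, (∀ d, (f d).fst = d.fst) ∧
        (∀ j < M, τ.arr 6 j < M ∧ D (τ.arr 6 j) = f (D j)) ∧
        (∀ j, i ≤ j → j < M → f (D j) = D j) ∧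
        (∀ j < i, ∀ j' < i, (D j).fst = (D j').fst → f.SameCycle (D j) (D j')) ∧
        (∀ v, τ.arr 7 (num v) = 0 → ∀ j < i, (D j).fst ≠ v) ∧
        (∀ v, τ.arr 7 (num v) ≠ 0 → τ.arr 7 (num v) - 1 < i ∧ (D (τ.arr 7 (num v) - 1)).fst = v))
        M ?_ ?_ ?_).mono ?_ ?_
  · rintro i τ hi ⟨hi3, hr, ha, f, hf1, hf2, hf3, hf4, hf5, hf6⟩
    have h5' : τ.reg 5 = M := (hr 5 (by decide) (by decide) (by decide)).trans h5
    have h4' : τ.arr 4 i = num (D i).fst := by rw [ha 4 (by decide) (by decide), h4 i hi]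
    refine ⟨by simpa [Operand.eval, hi3, h5'] using hi,
      LoopFree.runs (by simp [linkBody, LoopFree]) ?_⟩
    have hnum : ∀ v w : V, (num v : ℕ) = num w ↔ v = w := fun v w => by
      rw [Fin.val_inj, num.injective.eq_iff]
    by_cases h0 : τ.arr 7 (num (D i).fst) = 0
    · have hrun : linkBody.run τ =
          (((τ.setReg 9 (num (D i).fst)).setArr 7 (num (D i).fst) (i + 1)).setReg 3 (i + 1)) := by
        simp [linkBody, run, Operand.eval, Store.setReg_reg, Store.setArr_reg, Store.setReg_arr,
          hi3, h4', h0]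
      rw [hrun]
      refine ⟨by simp [Store.setReg_reg], fun r n3 n6 n9 => by
        simp [Store.setReg_reg, Store.setArr_reg, n3, n9, hr r n3 n6 n9], fun a n6 n7 => by
        rw [Store.setReg_arr, Store.setArr_arr_of_ne _ _ _ n7, Store.setReg_arr, ha a n6 n7],
        f, hf1, ?_, fun j hij => hf3 j (by omega), ?_, ?_, ?_⟩
      · simpa [Store.setReg_arr, Store.setArr_arr] using hf2
      · have hno := hf5 _ h0
        intro j hj j' hj' h
        rcases Nat.lt_succ_iff_lt_or_eq.1 hj with hlt | rfl <;>
          rcases Nat.lt_succ_iff_lt_or_eq.1 hj' with hlt' | rfl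
        · exact hf4 j hlt j' hlt' h
        · exact absurd h (hno j hlt)
        · exact absurd h.symm (hno j' hlt')
        · rfl
      · intro v hv j hj
        simp only [Store.setReg_arr, Store.setArr_arr, hnum, true_and] at hv
        split_ifs at hv with h
        rcases Nat.lt_succ_iff_lt_or_eq.1 hj with hlt | rfl
        · exact hf5 v hv j hlt
        · exact fun h' => h h'.symm
      · intro v hv
        simp only [Store.setReg_arr, Store.setArr_arr, hnum, true_and] at hv ⊢
        split_ifs at hv ⊢ with h
        · exact ⟨by omega, by rw [h]; rfl⟩
        · exact ⟨by have := (hf6 v hv).1; omega, (hf6 v hv).2⟩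
    · obtain ⟨ha1, ha2⟩ := hf6 _ h0
      set j₀ := τ.arr 7 (num (D i).fst) - 1 with hj₀
      have hne : j₀ ≠ i := by omega
      have hrun : linkBody.run τ = ((((((τ.setReg 9 (num (D i).fst)).setReg 6 j₀).setArr 6 i
          (τ.arr 6 j₀)).setArr 6 j₀ i).setArr 7 (num (D i).fst) (i + 1)).setReg 3 (i + 1)) := by
        simp [linkBody, run, Operand.eval, Store.setReg_reg, Store.setArr_reg, Store.setReg_arr,
          hi3, h4', Nat.pos_of_ne_zero h0, ← hj₀]
      obtain ⟨hsc, hsc'⟩ := Equiv.Perm.sameCycle_mul_swap (a := D j₀) (hf3 i le_rfl hi)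
      have h7' : ∀ v, (linkBody.run τ).arr 7 (num v) =
          if v = (D i).fst then i + 1 else τ.arr 7 (num v) := by
        intro v
        rw [hrun]
        simp [Store.setReg_arr, Store.setArr_arr, hnum]
      rw [hrun] at h7' ⊢
      refine ⟨by simp [Store.setReg_reg], fun r n3 n6 n9 => by
        simp [Store.setReg_reg, Store.setArr_reg, n3, n6, n9, hr r n3 n6 n9], fun a n6 n7 => by
        rw [Store.setReg_arr, Store.setArr_arr_of_ne _ _ _ n7, Store.setArr_arr_of_ne _ _ _ n6,
          Store.setArr_arr_of_ne _ _ _ n6, Store.setReg_arr, Store.setReg_arr, ha a n6 n7],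
        f * Equiv.swap (D j₀) (D i), ?_, ?_, ?_, ?_, ?_, ?_⟩
      · intro d
        rw [Equiv.Perm.mul_apply, hf1, Equiv.swap_apply_def]
        split_ifs with e1 e2
        · rw [e1, ha2]
        · rw [e2, ha2]
        · rfl
      · intro j hj
        have heval : ∀ b, (Store.setReg (((((τ.setReg 9 (num (D i).fst)).setReg 6 j₀).setArr 6 i
            (τ.arr 6 j₀)).setArr 6 j₀ i).setArr 7 (num (D i).fst) (i + 1)) 3 (i + 1)).arr 6 b =
            if b = j₀ then i else if b = i then τ.arr 6 j₀ else τ.arr 6 b := by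
          intro b
          simp [Store.setReg_arr, Store.setArr_arr]
        rw [heval, Equiv.Perm.mul_apply]
        split_ifs with e1 e2
        · rw [e1, Equiv.swap_apply_left]
          exact ⟨hi, (hf3 i le_rfl hi).symm⟩
        · rw [e2, Equiv.swap_apply_right]
          exact hf2 j₀ (by omega)
        · rw [Equiv.swap_apply_of_ne_of_ne]
          · exact hf2 j hj
          · exact fun h => e1 (hD.inj _ hj _ (by omega) h)
          · exact fun h => e2 (hD.inj _ hj _ hi h)
      · intro j hij hj
        rw [Equiv.Perm.mul_apply, Equiv.swap_apply_of_ne_of_ne]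
        · exact hf3 j (by omega) hj
        · intro h
          have := hD.inj _ hj _ (by omega) h
          omega
        · intro h
          have := hD.inj _ hj _ hi h
          omega
      · have key : ∀ j < i, (D j).fst = (D i).fst →
            (f * Equiv.swap (D j₀) (D i)).SameCycle (D j) (D i) := fun j hj h =>
          (hsc' _ _ (hf4 j hj j₀ ha1 (h.trans ha2.symm))).trans hsc
        intro j hj j' hj' h
        rcases Nat.lt_succ_iff_lt_or_eq.1 hj with hlt | rfl <;>
          rcases Nat.lt_succ_iff_lt_or_eq.1 hj' with hlt' | rfl
        · exact hsc' _ _ (hf4 j hlt j' hlt' h)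
        · exact key j hlt h
        · exact (key j' hlt' h.symm).symm
        · rfl
      · intro v hv j hj
        rw [h7'] at hv
        split_ifs at hv with h
        rcases Nat.lt_succ_iff_lt_or_eq.1 hj with hlt | rfl
        · exact hf5 v hv j hlt
        · exact fun h' => h h'.symm
      · intro v hv
        rw [h7'] at hv ⊢
        split_ifs at hv ⊢ with h
        · exact ⟨by omega, by rw [h]; rfl⟩
        · have := hf6 v hv
          exact ⟨by omega, this.2⟩
  · rintro τ ⟨hi3, hr, -⟩
    have h5' : τ.reg 5 = M := (hr 5 (by decide) (by decide) (by decide)).trans h5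
    simp [Operand.eval, hi3, h5']
  · exact ⟨h3, fun _ _ _ _ => rfl, fun _ _ _ => rfl, 1, fun _ => rfl,
      fun j hj => by rw [h6 j hj]; exact ⟨hj, rfl⟩, fun _ _ _ => rfl,
      fun j hj => absurd hj (Nat.not_lt_zero j), fun _ _ j hj => absurd hj (Nat.not_lt_zero j),
      fun v hv => absurd (h7 _) hv⟩
  · have : linkBody.time ≤ 97 := by decide
    simp only [Operand.cost]
    nlinarith
  · rintro τ ⟨-, h1, h2, f, hf1, hf2, -, hf4, -⟩
    refine ⟨h1, h2, ⟨f, hf1, fun d d' h => ?_⟩, hf2⟩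
    obtain ⟨j, hj, rfl⟩ := hD.surj d
    obtain ⟨j', hj', rfl⟩ := hD.surj d'
    exact hf4 j hj j' hj' h

end RAM

/-! ### Visit counters. -/

namespace SimpleGraph

/-- The number of indices in `[a, b]` at which a sequence takes the value `v`. -/
noncomputable def visits {V : Type*} (x : ℕ → V) (a b : ℕ) (v : V) : ℕ :=
  open Classical in {i ∈ Finset.Icc a b | x i = v}.card

section Visits

variable {V : Type*} {x : ℕ → V} {a b : ℕ}

theorem visits_pos {v : V} : 0 < visits x a b v ↔ v ∈ window x a b := by
  classical
  rw [visits, Finset.card_pos, mem_window]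
  simp [Finset.Nonempty, and_assoc]

theorem visits_self [DecidableEq V] (v : V) : visits x a a v = if v = x a then 1 else 0 := by
  classical
  split_ifs with h
  · subst h
    simp [visits, Finset.filter_singleton]
  · simp [visits, Finset.filter_singleton, Ne.symm h]

theorem visits_succ_right [DecidableEq V] (h : a ≤ b + 1) (v : V) :
    visits x a (b + 1) v = visits x a b v + if v = x (b + 1) then 1 else 0 := by
  classical
  have hI : Finset.Icc a (b + 1) = insert (b + 1) (Finset.Icc a b) := by
    ext i
    simp only [Finset.mem_Icc, Finset.mem_insert]
    omega
  simp only [visits, hI, Finset.filter_insert, eq_comm (a := x (b + 1))]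
  split_ifs with hv
  · rw [Finset.card_insert_of_notMem (by simp)]
  · rfl

theorem visits_succ_left [DecidableEq V] (h : a ≤ b) (v : V) :
    visits x a b v = visits x (a + 1) b v + if v = x a then 1 else 0 := by
  classical
  have hI : Finset.Icc a b = insert a (Finset.Icc (a + 1) b) := by
    ext i
    simp only [Finset.mem_Icc, Finset.mem_insert]
    omega
  simp only [visits, hI, Finset.filter_insert, eq_comm (a := x a)]
  split_ifs with hv
  · rw [Finset.card_insert_of_notMem (by simp)]
  · rfl

end Visits

end SimpleGraph

/-! ### The search loop and the output loop on the machine. -/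

namespace RAM

open Program SimpleGraph

/-- The arrays of a store describe the rotation system `R`. -/
structure Encodes {V : Type*} {T : SimpleGraph V} {N : ℕ} (R : T.RotationSystem) (c : V → ℕ)
    (k g M : ℕ) (D : ℕ → T.Dart) (num : V ≃ Fin N) (σ : Store) : Prop where
  reg0 : σ.reg 0 = N
  reg1 : σ.reg 1 = k
  reg2 : σ.reg 2 = g
  arr0 : ∀ v, σ.arr 0 (num v) = c v
  arr3 : ∀ i, σ.arr 3 i = 0
  arr4 : ∀ j < M, σ.arr 4 j = num (D j).fst
  arr5 : ∀ j < M, σ.arr 5 j < M ∧ D (σ.arr 5 j) = (D j).symm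
  arr6 : ∀ j < M, σ.arr 6 j < M ∧ D (σ.arr 6 j) = R.rot (D j)

/-- The store describes the path of the Euler tour from position `a` to position `b`. -/
structure EncodesPath {V : Type*} {T : SimpleGraph V} {N : ℕ} (R : T.RotationSystem) (c : V → ℕ)
    (k g M : ℕ) (D : ℕ → T.Dart) (num : V ≃ Fin N) (a b : ℕ) (σ : Store) : Prop
    extends Encodes R c k g M D num σ where
  reg6 : σ.reg 6 < M ∧ D (σ.reg 6) = R.tourNext^[a] (D 0)
  reg7 : σ.reg 7 < M ∧ D (σ.reg 7) = R.tourNext^[b] (D 0)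
  reg8 : σ.reg 8 = windowWeight c (R.tourVertex (D 0)) a b
  reg10 : σ.reg 10 = 0
  arr8 : ∀ v, σ.arr 8 (num v) = visits (R.tourVertex (D 0)) a b v

section

variable {V : Type*} {T : SimpleGraph V} {N : ℕ} {R : T.RotationSystem} {c : V → ℕ}
  {k g M : ℕ} {D : ℕ → T.Dart} {num : V ≃ Fin N} {a b : ℕ} {σ τ : Store}

theorem Encodes.congr (h : Encodes R c k g M D num σ) (h0 : τ.reg 0 = σ.reg 0)
    (h1 : τ.reg 1 = σ.reg 1) (h2 : τ.reg 2 = σ.reg 2) (ha : ∀ a, a ≤ 7 → τ.arr a = σ.arr a) :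
    Encodes R c k g M D num τ where
  reg0 := h0.trans h.reg0
  reg1 := h1.trans h.reg1
  reg2 := h2.trans h.reg2
  arr0 := ha 0 (by decide) ▸ h.arr0
  arr3 := ha 3 (by decide) ▸ h.arr3
  arr4 := ha 4 (by decide) ▸ h.arr4
  arr5 := ha 5 (by decide) ▸ h.arr5
  arr6 := ha 6 (by decide) ▸ h.arr6

theorem Encodes.next (h : Encodes R c k g M D num σ) {j : ℕ} (hj : j < M) :
    σ.arr 6 (σ.arr 5 j) < M ∧ D (σ.arr 6 (σ.arr 5 j)) = R.tourNext (D j) := by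
  obtain ⟨h1, h2⟩ := h.arr5 j hj
  obtain ⟨h3, h4⟩ := h.arr6 _ h1
  exact ⟨h3, by rw [h4, h2, RotationSystem.tourNext]⟩

theorem val_eq_iff (num : V ≃ Fin N) (v w : V) : (num v : ℕ) = num w ↔ v = w := by
  rw [Fin.val_inj, num.injective.eq_iff]

theorem EncodesPath.grow (h : EncodesPath R c k g M D num a b σ) (hab : a ≤ b) :
    EncodesPath R c k g M D num a (b + 1) (growBody.run σ) := by
  classical
  obtain ⟨hn1, hn2⟩ := h.next h.reg7.1
  rw [h.reg7.2, ← Function.iterate_succ_apply' R.tourNext] at hn2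
  have h4 := h.arr4 _ hn1
  rw [hn2] at h4
  change _ = ((num (R.tourVertex (D 0) (b + 1)) : Fin N) : ℕ) at h4
  set x := R.tourVertex (D 0) with hx
  set t := σ.arr 6 (σ.arr 5 (σ.reg 7)) with ht
  have h8 : σ.arr 8 (num (x (b + 1))) = visits x a b (x (b + 1)) := h.arr8 _
  have hr8 : σ.reg 8 = windowWeight c x a b := h.reg8
  set W := windowWeight c x a (b + 1) with hW
  have hrun : growBody.run σ = if 0 < visits x a b (x (b + 1)) then
        ((σ.setReg 7 t).setReg 9 (num (x (b + 1)))).setArr 8 (num (x (b + 1)))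
          (visits x a b (x (b + 1)) + 1)
      else (((σ.setReg 7 t).setReg 9 (num (x (b + 1)))).setReg 8
        (windowWeight c x a b + c (x (b + 1)))).setArr 8 (num (x (b + 1)))
          (visits x a b (x (b + 1)) + 1) := by
    by_cases h0 : 0 < visits x a b (x (b + 1)) <;>
      simp [growBody, run, Operand.eval, Store.setReg_reg, Store.setReg_arr, ← ht, h4, h8, hr8,
        h.arr0, h0]
  have hrun' : growBody.run σ = (((σ.setReg 7 t).setReg 9 (num (x (b + 1)))).setReg 8 W).setArr 8
      (num (x (b + 1))) (visits x a b (x (b + 1)) + 1) := by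
    rw [hrun]
    split_ifs with h0
    · rw [visits_pos] at h0
      have hWe : W = σ.reg 8 := by rw [hW, windowWeight_succ_right_of_mem c h0, h.reg8]
      congr 1
      simp only [Store.setReg, hWe, Store.mk.injEq, and_true]
      funext r
      by_cases hr : r = 8 <;> simp [Function.update_apply, hr]
    · rw [visits_pos] at h0
      rw [hW, windowWeight_succ_right_of_notMem c (by omega) h0]
  rw [hrun']
  refine ⟨h.toEncodes.congr ?_ ?_ ?_ fun a ha => ?_, ?_, ?_, ?_, ?_, fun v => ?_⟩
  · simp [Store.setReg_reg, Store.setArr_reg]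
  · simp [Store.setReg_reg, Store.setArr_reg]
  · simp [Store.setReg_reg, Store.setArr_reg]
  · rw [Store.setArr_arr_of_ne _ _ _ (by omega)]
    rfl
  · simpa [Store.setReg_reg, Store.setArr_reg] using h.reg6
  · simpa [Store.setReg_reg, Store.setArr_reg] using And.intro hn1 hn2
  · simp [Store.setReg_reg, Store.setArr_reg, hW, hx]
  · simpa [Store.setReg_reg, Store.setArr_reg] using h.reg10
  · change _ = visits x a (b + 1) v
    rw [Store.setArr_arr, visits_succ_right (by omega)]
    simp only [val_eq_iff, true_and]
    split_ifs with hv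
    · rw [hv]
    · simp [Store.setReg_arr, h.arr8, hx]

theorem EncodesPath.shrink (h : EncodesPath R c k g M D num a b σ) (hab : a + 1 ≤ b) :
    EncodesPath R c k g M D num (a + 1) b (shrinkBody.run σ) := by
  classical
  obtain ⟨hn1, hn2⟩ := h.next h.reg6.1
  rw [h.reg6.2, ← Function.iterate_succ_apply' R.tourNext] at hn2
  have h4 := h.arr4 _ h.reg6.1
  rw [h.reg6.2] at h4
  change _ = ((num (R.tourVertex (D 0) a) : Fin N) : ℕ) at h4
  set x := R.tourVertex (D 0) with hx
  set t := σ.arr 6 (σ.arr 5 (σ.reg 6)) with ht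
  have hr8 : σ.reg 8 = windowWeight c x a b := h.reg8
  have h8 : σ.arr 8 (num (x a)) - 1 = visits x (a + 1) b (x a) := by
    rw [h.arr8, visits_succ_left (by omega), if_pos rfl, Nat.add_sub_cancel]
  set W := windowWeight c x (a + 1) b with hW
  have hrun : shrinkBody.run σ = if 0 < visits x (a + 1) b (x a) then
        (((σ.setReg 9 (num (x a))).setArr 8 (num (x a)) (visits x (a + 1) b (x a))).setReg 6 t)
      else ((((σ.setReg 9 (num (x a))).setArr 8 (num (x a)) (visits x (a + 1) b (x a))).setReg 8
        (windowWeight c x a b - c (x a))).setReg 6 t) := by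
    by_cases h0 : 0 < visits x (a + 1) b (x a) <;>
      simp [shrinkBody, run, Operand.eval, Store.setReg_reg, Store.setReg_arr, Store.setArr_arr,
        Store.setArr_reg, h4, h8, hr8, h.arr0, ← ht, h0]
  have hrun' : shrinkBody.run σ = ((((σ.setReg 9 (num (x a))).setArr 8 (num (x a))
      (visits x (a + 1) b (x a))).setReg 8 W).setReg 6 t) := by
    rw [hrun]
    split_ifs with h0
    · rw [visits_pos] at h0
      have hWe : W = σ.reg 8 := by rw [hW, ← windowWeight_succ_left_of_mem c h0, h.reg8]
      congr 1
      simp only [Store.setReg, Store.setArr, hWe, Store.mk.injEq, and_true]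
      funext r
      by_cases hr : r = 8 <;> simp [Function.update_apply, hr]
    · rw [visits_pos] at h0
      rw [hW, windowWeight_succ_left_of_notMem c (by omega) h0, Nat.add_sub_cancel]
  rw [hrun']
  refine ⟨h.toEncodes.congr ?_ ?_ ?_ fun a ha => ?_, ?_, ?_, ?_, ?_, fun v => ?_⟩
  · simp [Store.setReg_reg, Store.setArr_reg]
  · simp [Store.setReg_reg, Store.setArr_reg]
  · simp [Store.setReg_reg, Store.setArr_reg]
  · rw [Store.setReg_arr, Store.setReg_arr, Store.setArr_arr_of_ne _ _ _ (by omega)]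
    rfl
  · simpa [Store.setReg_reg, Store.setArr_reg] using And.intro hn1 hn2
  · simpa [Store.setReg_reg, Store.setArr_reg] using h.reg7
  · simp [Store.setReg_reg, hW, hx]
  · simpa [Store.setReg_reg, Store.setArr_reg] using h.reg10
  · change _ = visits x (a + 1) b v
    rw [Store.setReg_arr, Store.setReg_arr, Store.setArr_arr]
    simp only [val_eq_iff, true_and]
    split_ifs with hv
    · rw [hv]
    · rw [Store.setReg_arr, h.arr8, visits_succ_left (a := a) (by omega), if_neg hv, add_zero]

/-- Each constructor of `SearchPath` is one round of the loop, and its weight hypotheses decide the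
two tests. -/
theorem runs_search {n a' b' : ℕ} (hp : SearchPath c k g M (R.tourVertex (D 0)) a b n a' b')
    (h : EncodesPath R c k g M D num a b σ) :
    (whileLt (.reg 10) (.lit 1) searchBody).Runs σ ((n + 1) * 200) fun τ =>
      Encodes R c k g M D num τ ∧
        ∀ v, τ.arr 8 (num v) = visits (R.tourVertex (D 0)) a' b' v := by
  have htime : searchBody.time ≤ 190 := by decide
  have hfree : searchBody.LoopFree := by simp [searchBody, growBody, shrinkBody, LoopFree]
  have hcond : ∀ {a b σ}, EncodesPath R c k g M D num a b σ →
      (Operand.reg 10).eval σ < (Operand.lit 1).eval σ := fun h => by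
    simp [Operand.eval, h.reg10]
  have hrun : ∀ {a b σ}, EncodesPath R c k g M D num a b σ → searchBody.run σ =
      if windowWeight c (R.tourVertex (D 0)) a b + g < k + 1 then growBody.run σ else
      if k < windowWeight c (R.tourVertex (D 0)) a b then shrinkBody.run σ else
      σ.setReg 10 1 := fun h => by
    simp only [searchBody, run, Operand.eval, h.reg8, h.reg1, h.reg2]
  induction hp generalizing σ with
  | done hab hba hge hle =>
    obtain ⟨n, hn, he⟩ := hfree.exec σ
    rw [hrun h, if_neg (by omega), if_neg (by omega)] at he
    refine ⟨_, _, .whileTrue (hcond h) he (.whileFalse ?_), ?_,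
      h.toEncodes.congr ?_ ?_ ?_ fun _ _ => rfl, h.arr8⟩
    · simp [Operand.eval, Store.setReg_reg]
    · simp only [Operand.cost]
      omega
    · simp [Store.setReg_reg]
    · simp [Store.setReg_reg]
    · simp [Store.setReg_reg]
  | grow hab hba hlt _ ih =>
    obtain ⟨n, hn, he⟩ := hfree.exec σ
    rw [hrun h, if_pos (by omega)] at he
    obtain ⟨n', τ, he', hn', hQ⟩ := ih (h.grow hab)
    refine ⟨_, τ, .whileTrue (hcond h) he he', ?_, hQ⟩
    simp only [Operand.cost]
    omega
  | shrink hab hba hgt _ ih =>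
    obtain ⟨n, hn, he⟩ := hfree.exec σ
    rw [hrun h, if_neg (by omega), if_pos hgt] at he
    obtain ⟨n', τ, he', hn', hQ⟩ := ih (h.shrink hab)
    refine ⟨_, τ, .whileTrue (hcond h) he he', ?_, hQ⟩
    simp only [Operand.cost]
    omega

theorem runs_output (h0 : σ.reg 0 = N) (h3 : σ.reg 3 = 0) (h : ∀ i, σ.arr 3 i = 0) :
    (whileLt (.reg 3) (.reg 0) outputBody).Runs σ (N * 30 + 3) fun τ =>
      ∀ i < N, τ.arr 3 i = if 0 < σ.arr 8 i then 1 else 0 := by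
  refine (runs_whileLt (B := outputBody.time) (I := fun i τ => τ.reg 3 = i ∧ τ.reg 0 = N ∧
      τ.arr 8 = σ.arr 8 ∧ (∀ j < i, τ.arr 3 j = if 0 < σ.arr 8 j then 1 else 0) ∧
      ∀ j, i ≤ j → τ.arr 3 j = 0) N ?_ ?_ ?_).mono ?_ ?_
  · rintro i τ hi ⟨h1, h2, h3, h4, h5⟩
    refine ⟨by simpa [Operand.eval, h1, h2] using hi,
      LoopFree.runs (by simp [outputBody, LoopFree]) ?_⟩
    by_cases hpos : 0 < σ.arr 8 i
    · have hrun : outputBody.run τ = (τ.setArr 3 i 1).setReg 3 (i + 1) := by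
        simp [outputBody, run, Operand.eval, h1, h3, hpos, Store.setArr_reg]
      rw [hrun]
      refine ⟨by simp [Store.setReg_reg], by simp [Store.setReg_reg, Store.setArr_reg, h2], ?_,
        fun j hj => ?_, fun j hj => ?_⟩
      · rw [Store.setReg_arr, Store.setArr_arr_of_ne _ _ _ (by decide), h3]
      · rw [Store.setReg_arr, Store.setArr_arr]
        by_cases hji : j = i
        · simp [hji, hpos]
        · simp [hji, h4 j (by omega)]
      · rw [Store.setReg_arr, Store.setArr_arr, if_neg (by omega), h5 j (by omega)]
    · have hrun : outputBody.run τ = τ.setReg 3 (i + 1) := by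
        simp [outputBody, run, Operand.eval, h1, h3, hpos]
      rw [hrun]
      refine ⟨by simp [Store.setReg_reg], by simp [Store.setReg_reg, h2], h3,
        fun j hj => ?_, fun j hj => h5 j (by omega)⟩
      rcases Nat.lt_succ_iff_lt_or_eq.1 hj with hlt | rfl
      · exact h4 j hlt
      · rw [if_neg hpos]
        exact h5 j le_rfl
  · rintro τ ⟨h1, h2, -⟩
    simp [Operand.eval, h1, h2]
  · exact ⟨h3, h0, rfl, fun j hj => absurd hj (Nat.not_lt_zero j), fun j _ => h j⟩
  · have : outputBody.time ≤ 27 := by decide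
    simp only [Operand.cost]
    nlinarith
  · rintro τ ⟨-, -, -, h4, -⟩
    exact h4

end

end RAM

/-! ### Correctness and running time of the whole program. -/

namespace RAM

open Program SimpleGraph

theorem ListsEdges.exists_dartNumbering {V : Type*} {T : SimpleGraph V} {m : ℕ}
    {ends : Fin m → V × V} (h : ListsEdges T ends) (hm : 0 < m) :
    ∃ D : ℕ → T.Dart, IsDartNumbering (m + m) D ∧
      ∀ (j : ℕ) (hj : j < m), (D j).fst = (ends ⟨j, hj⟩).1 ∧
        (D (j + m)).fst = (ends ⟨j, hj⟩).2 ∧ D (j + m) = (D j).symm := by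
  have hadj : ∀ i, T.Adj (ends i).1 (ends i).2 := fun i => by
    rw [← mem_edgeSet, ← h.2]
    exact ⟨i, rfl⟩
  set E : Fin m → T.Dart := fun i => ⟨ends i, hadj i⟩ with hE
  have hedge : ∀ i, (E i).edge = s((ends i).1, (ends i).2) := fun i => rfl
  have hEinj : ∀ i j, (E i).edge = (E j).edge → i = j := fun i j hij => h.1 hij
  -- The layout of `initBody`; the values from `m + m` on are irrelevant.
  set D : ℕ → T.Dart := fun j =>
    if hj : j < m then E ⟨j, hj⟩
    else if hj : j - m < m then (E ⟨j - m, hj⟩).symm else E ⟨0, hm⟩ with hD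
  have h1 : ∀ (j : ℕ) (hj : j < m), D j = E ⟨j, hj⟩ := fun j hj => dif_pos hj
  have h2 : ∀ (j : ℕ) (hj : j < m), D (j + m) = (E ⟨j, hj⟩).symm := fun j hj => by
    rw [hD]
    simp [hj]
  have hcases : ∀ j < m + m, j < m ∨ ∃ i < m, j = i + m := fun j hj => by
    rcases Nat.lt_or_ge j m with h | h
    · exact .inl h
    · exact .inr ⟨j - m, by omega, by omega⟩
  refine ⟨D, ⟨?_, ?_⟩, fun j hj => ?_⟩
  · intro i hi j hj hij
    have he := congrArg Dart.edge hij
    rcases hcases i hi with hi' | ⟨i, hi', rfl⟩ <;> rcases hcases j hj with hj' | ⟨j, hj', rfl⟩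
    · rw [h1 i hi', h1 j hj'] at he
      exact Fin.mk.inj_iff.1 (hEinj _ _ he)
    · rw [h1 i hi', h2 j hj', Dart.edge_symm] at he
      obtain rfl := Fin.mk.inj_iff.1 (hEinj _ _ he)
      rw [h1 i hi', h2 i hi'] at hij
      exact absurd hij.symm (Dart.symm_ne _)
    · rw [h2 i hi', h1 j hj', Dart.edge_symm] at he
      obtain rfl := Fin.mk.inj_iff.1 (hEinj _ _ he)
      rw [h1 i hi', h2 i hi'] at hij
      exact absurd hij (Dart.symm_ne _)
    · rw [h2 i hi', h2 j hj', Dart.edge_symm, Dart.edge_symm] at he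
      rw [Fin.mk.inj_iff.1 (hEinj _ _ he)]
  · intro d
    have hd : d.edge ∈ Set.range (fun i => s((ends i).1, (ends i).2)) := h.2 ▸ d.edge_mem
    obtain ⟨i, hi⟩ := hd
    have hi : (E i).edge = d.edge := hi
    rcases dart_edge_eq_iff _ _ |>.1 hi with hi | hi
    · exact ⟨i, by omega, by rw [h1 i i.2, ← hi]⟩
    · refine ⟨i + m, by omega, ?_⟩
      rw [h2 i i.2, Fin.eta, hi, Dart.symm_symm]
  · rw [h1 j hj, h2 j hj]
    exact ⟨rfl, rfl, rfl⟩

theorem Encodes.start {V : Type*} {T : SimpleGraph V} {N : ℕ} {R : T.RotationSystem} {c : V → ℕ}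
    {k g M : ℕ} {D : ℕ → T.Dart} {num : V ≃ Fin N} {σ : Store} (h : Encodes R c k g M D num σ)
    (hM : 0 < M) (h8 : ∀ i, σ.arr 8 i = 0) :
    EncodesPath R c k g M D num 0 0 (startSearch.run σ) := by
  classical
  have h4 := h.arr4 0 hM
  have hrun : startSearch.run σ = (((((σ.setReg 6 0).setReg 7 0).setReg 9 (num (D 0).fst)).setArr 8
      (num (D 0).fst) 1).setReg 8 (c (D 0).fst)).setReg 10 0 := by
    simp [startSearch, run, Operand.eval, Store.setReg_reg, Store.setReg_arr, Store.setArr_arr,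
      Store.setArr_reg, h4, h.arr0]
  rw [hrun]
  refine ⟨h.congr ?_ ?_ ?_ fun a ha => ?_, ?_, ?_, ?_, ?_, fun v => ?_⟩
  · simp [Store.setReg_reg, Store.setArr_reg]
  · simp [Store.setReg_reg, Store.setArr_reg]
  · simp [Store.setReg_reg, Store.setArr_reg]
  · rw [Store.setReg_arr, Store.setReg_arr, Store.setArr_arr_of_ne _ _ _ (by omega)]
    rfl
  · simpa [Store.setReg_reg, Store.setArr_reg] using hM
  · simpa [Store.setReg_reg, Store.setArr_reg] using hM
  · simp [Store.setReg_reg, windowWeight_self, RotationSystem.tourVertex]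
  · simp [Store.setReg_reg]
  · rw [visits_self, Store.setReg_arr, Store.setReg_arr, Store.setArr_arr]
    simp only [val_eq_iff, true_and]
    simp [RotationSystem.tourVertex, Store.setReg_arr, h8]
    split_ifs with hv <;> simp [hv]

/-- The program carries out the search along some Euler tour, in linear time. -/
theorem runs_treeProgram {V : Type*} [Fintype V] {T : SimpleGraph V} (hT : T.IsTree)
    {c : V → ℕ} {k g N : ℕ} (hN : Fintype.card V = N) (hN2 : 2 ≤ N)
    (hpath : ∀ (R : T.RotationSystem) (d : T.Dart), ∃ n ≤ 6 * N, ∃ a b,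
      SearchPath c k g (Nat.card T.Dart) (R.tourVertex d) 0 0 n a b)
    (num : V ≃ Fin N) {m : ℕ} (hm : m + 1 = N) {ends : Fin m → V × V} (h : ListsEdges T ends) :
    treeProgram.Runs (inputStore k g c num ends) (2000 * N) fun τ =>
      ∃ (R : T.RotationSystem) (d : T.Dart) (n a b : ℕ),
        SearchPath c k g (Nat.card T.Dart) (R.tourVertex d) 0 0 n a b ∧
        Outputs num τ (window (R.tourVertex d) a b) := by
  set σ := inputStore k g c num ends with hσ
  obtain ⟨D, hD, hDe⟩ := h.exists_dartNumbering (by omega)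
  have hM : Nat.card T.Dart = m + m := by
    have := RotationSystem.card_dart hT
    omega
  simp only [hM] at hpath ⊢
  have hpre : (Program.seq (.assign 4 (.sub (.reg 0) (.lit 1)))
      (.assign 5 (.add (.reg 4) (.reg 4)))).run σ = (σ.setReg 4 m).setReg 5 (m + m) := by
    simp [run, Operand.eval, Store.setReg_reg, hσ, inputStore, ← hm]
  -- The summands bound the successive stages; by `m + 1 = N` they add up to `1530 * N - 49`.
  have hmain : (Program.seq (.seq (.assign 4 (.sub (.reg 0) (.lit 1)))
      (.assign 5 (.add (.reg 4) (.reg 4)))) <|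
      .seq (.whileLt (.reg 3) (.reg 4) initBody) <|
      .seq (.assign 3 (.lit 0)) <|
      .seq (.whileLt (.reg 3) (.reg 5) linkBody) <|
      .seq startSearch <|
      .seq (.whileLt (.reg 10) (.lit 1) searchBody) <|
      .seq (.assign 3 (.lit 0)) <|
      .whileLt (.reg 3) (.reg 0) outputBody).Runs σ
      (8 + ((m * 100 + 3) + (2 + (((m + m) * 100 + 3) + (30 + ((6 * N + 1) * 200 +
        (2 + (N * 30 + 3)))))))) fun τ =>
      ∃ (R : T.RotationSystem) (d : T.Dart) (n a b : ℕ),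
        SearchPath c k g (m + m) (R.tourVertex d) 0 0 n a b ∧
        Outputs num τ (window (R.tourVertex d) a b) := by
    refine ((LoopFree.runs (Q := fun τ => τ = (σ.setReg 4 m).setReg 5 (m + m)) (by simp [LoopFree])
      hpre).mono (by decide) fun _ h => h).seq ?_
    rintro _ rfl
    refine (runs_init (σ := (σ.setReg 4 m).setReg 5 (m + m)) (m := m) ?_ ?_).seq ?_
    · simp [Store.setReg_reg, hσ, inputStore]
    · simp [Store.setReg_reg]
    rintro τ ⟨hr, ha, hj⟩
    refine (LoopFree.runs (Q := fun τ' => τ' = τ.setReg 3 0) (by simp [LoopFree]) rfl).seq ?_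
    rintro _ rfl
    have harr : ∀ a, a ≠ 4 → a ≠ 5 → a ≠ 6 → τ.arr a = σ.arr a := ha
    have hj : ∀ j < m, τ.arr 4 j = σ.arr 1 j ∧ τ.arr 4 (j + m) = σ.arr 2 j ∧
        τ.arr 5 j = j + m ∧ τ.arr 5 (j + m) = j ∧ τ.arr 6 j = j ∧ τ.arr 6 (j + m) = j + m := hj
    have hcases : ∀ j < m + m, j < m ∨ ∃ i < m, j = i + m := fun j hj => by
      rcases Nat.lt_or_ge j m with h | h
      · exact .inl h
      · exact .inr ⟨j - m, by omega, by omega⟩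
    have h4 : ∀ j < m + m, τ.arr 4 j = num (D j).fst := by
      intro j hjM
      rcases hcases j hjM with hjm | ⟨i, hi, rfl⟩
      · rw [(hj j hjm).1, (hDe j hjm).1]
        simp [hσ, inputStore, hjm]
      · rw [(hj i hi).2.1, (hDe i hi).2.1]
        simp [hσ, inputStore, hi]
    have h5 : ∀ j < m + m, τ.arr 5 j < m + m ∧ D (τ.arr 5 j) = (D j).symm := by
      intro j hjM
      rcases hcases j hjM with hjm | ⟨i, hi, rfl⟩
      · rw [(hj j hjm).2.2.1]
        exact ⟨by omega, (hDe j hjm).2.2⟩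
      · rw [(hj i hi).2.2.2.1, (hDe i hi).2.2, Dart.symm_symm]
        exact ⟨by omega, rfl⟩
    have h6 : ∀ j < m + m, τ.arr 6 j = j := by
      intro j hjM
      rcases hcases j hjM with hjm | ⟨i, hi, rfl⟩
      · exact (hj j hjm).2.2.2.2.1
      · exact (hj i hi).2.2.2.2.2
    refine (runs_link (σ := τ.setReg 3 0) hD num ?_ ?_ h4 h6 fun j => ?_).seq ?_
    · simp [Store.setReg_reg]
    · simp [Store.setReg_reg, hr]
    · rw [Store.setReg_arr, harr 7 (by decide) (by decide) (by decide)]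
      rfl
    rintro υ ⟨hr', ha', R, hR⟩
    have henc : Encodes R c k g (m + m) D num υ := by
      refine ⟨?_, ?_, ?_, fun v => ?_, fun i => ?_, fun j hjM => ?_, fun j hjM => ?_, hR⟩
      · rw [hr' 0 (by decide) (by decide) (by decide)]
        simp [Store.setReg_reg, hr, hσ, inputStore]
      · rw [hr' 1 (by decide) (by decide) (by decide)]
        simp [Store.setReg_reg, hr, hσ, inputStore]
      · rw [hr' 2 (by decide) (by decide) (by decide)]
        simp [Store.setReg_reg, hr, hσ, inputStore]
      · rw [ha' 0 (by decide) (by decide), Store.setReg_arr,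
          harr 0 (by decide) (by decide) (by decide)]
        simp [hσ, inputStore]
      · rw [ha' 3 (by decide) (by decide), Store.setReg_arr,
          harr 3 (by decide) (by decide) (by decide)]
        rfl
      · rw [ha' 4 (by decide) (by decide)]
        exact h4 j hjM
      · rw [ha' 5 (by decide) (by decide)]
        exact h5 j hjM
    have h8 : ∀ i, υ.arr 8 i = 0 := fun i => by
      rw [ha' 8 (by decide) (by decide), Store.setReg_arr,
        harr 8 (by decide) (by decide) (by decide)]
      rfl
    refine ((LoopFree.runs (Q := EncodesPath R c k g (m + m) D num 0 0)
      (by simp [startSearch, LoopFree]) (henc.start (by omega) h8)).mono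
      (by decide) fun _ h => h).seq fun ω hω => ?_
    obtain ⟨n, hn, a, b, hp⟩ := hpath R (D 0)
    refine ((runs_search hp hω).mono (Nat.mul_le_mul_right 200 (Nat.succ_le_succ hn))
      fun _ h => h).seq ?_
    rintro ξ ⟨hξ, hξ8⟩
    refine (LoopFree.runs (Q := fun ξ' => ξ' = ξ.setReg 3 0) (by simp [LoopFree]) rfl).seq ?_
    rintro _ rfl
    refine (runs_output (σ := ξ.setReg 3 0) (N := N) ?_ ?_ hξ.arr3).mono le_rfl fun ζ hζ => ?_
    · simpa [Store.setReg_reg] using hξ.reg0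
    · simp [Store.setReg_reg]
    refine ⟨R, D 0, n, a, b, hp, fun v => ?_⟩
    rw [hζ _ (num v).2, Store.setReg_arr, hξ8, Finset.mem_coe, ← visits_pos]
    constructor <;> intro hv <;> simp [hv]
  obtain ⟨n, τ, he, hn, hQ⟩ := hmain
  refine ⟨_, τ, .ifFalse ?_ he, ?_, hQ⟩
  · simp only [Operand.eval, hσ, inputStore]
    omega
  · simp only [Operand.cost]
    omega

/-- This lets the bare existence of a subtree be read off from the program. -/
theorem listsEdges_exists {V : Type*} [Fintype V] {T : SimpleGraph V} (hT : T.IsTree) {N : ℕ}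
    (hN : Fintype.card V = N) : ∃ ends : Fin (N - 1) → V × V, ListsEdges T ends := by
  classical
  have hcard : Fintype.card T.edgeSet = N - 1 := by
    have := hT.card_edgeFinset
    rw [← edgeFinset_card]
    omega
  let e : Fin (N - 1) ≃ T.edgeSet := (Fintype.equivFinOfCardEq hcard).symm
  have hout : ∀ i, s((Quot.out (e i).1).1, (Quot.out (e i).1).2) = (e i).1 := fun i =>
    Quot.out_eq (e i).1
  refine ⟨fun i => Quot.out (e i).1, fun i j hij => ?_, ?_⟩
  · simp only [hout] at hij
    exact e.injective (Subtype.ext hij)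
  · simp only [hout]
    ext x
    constructor
    · rintro ⟨i, rfl⟩
      exact (e i).2
    · intro hx
      exact ⟨e.symm ⟨x, hx⟩, by simp⟩

end RAM

/-! ### Assembly of the three claims. -/

theorem lemma1 :
    ∃ (P : RAM.Program) (C : ℕ),
      ∀ (V : Type*) [Fintype V] (T : SimpleGraph V) (c : V → ℕ) (k g N₁ N₂ : ℕ) (h : ℤ),
        0 < g → 1 ≤ k → k ≤ N₂ →
        h = 2 * (N₁ : ℤ) - N₂ →
        (g : ℤ) + h > 2 →
        2 * (k : ℤ) - 4 * g - h + 3 ≤ N₂ →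
        (N₂ : ℤ) ≤ 2 * k + g + h - 2 →
        T.IsTree → Fintype.card V = N₁ →
        (∀ v, 0 < c v) → ∑ v, c v = N₂ → (∀ v, c v ≤ k) →
        -- a subtree of the desired weight exists
        (∃ S : T.Subgraph, SimpleGraph.IsSubtreeOfWeight c k g S) ∧
        -- for every Euler tour and every start, the search finds one in at most `C * N₁` moves
        (∀ (R : T.RotationSystem) (d : T.Dart), ∃ (n : ℕ) (x y : T.Dart),
          R.Search c k g SimpleGraph.RotationSystem.Phase.overload d d n x y ∧ n ≤ C * N₁ ∧
          SimpleGraph.IsSubtreeOfWeight c k g (R.tourSubtree x y)) ∧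
        -- the program `P` computes one, the result of such a search, in at most `C * N₁` steps
        (∀ (num : V ≃ Fin N₁) (ends : Fin (N₁ - 1) → V × V), RAM.ListsEdges T ends →
          ∃ (S : T.Subgraph) (n : ℕ) (τ : RAM.Store),
            SimpleGraph.IsSubtreeOfWeight c k g S ∧
            (2 ≤ N₁ → ∃ (R : T.RotationSystem) (d : T.Dart) (i : ℕ) (x y : T.Dart),
              R.Search c k g SimpleGraph.RotationSystem.Phase.overload d d i x y ∧
              S = R.tourSubtree x y) ∧
            RAM.Exec P (RAM.inputStore k g c num ends) n τ ∧ n ≤ C * N₁ ∧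
            RAM.Outputs num τ S.verts) := by
  refine ⟨RAM.treeProgram, 2000, ?_⟩
  intro V _ T c k g N₁ N₂ h hg hk1 hk hh hgh hlow hup hT hN₁ hc hN₂ hck
  subst hh
  have hpath : ∀ (R : T.RotationSystem) (d : T.Dart), ∃ n ≤ 6 * N₁, ∃ a b,
      SimpleGraph.SearchPath c k g (Nat.card T.Dart) (R.tourVertex d) 0 0 n a b := fun R d =>
    R.exists_searchPath_of_tree hT d hg hk hgh hlow hup hN₁ hN₂ hc hck
  have hprog : ∀ (num : V ≃ Fin N₁) (ends : Fin (N₁ - 1) → V × V), RAM.ListsEdges T ends →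
      ∃ (S : T.Subgraph) (n : ℕ) (τ : RAM.Store),
        SimpleGraph.IsSubtreeOfWeight c k g S ∧
        (2 ≤ N₁ → ∃ (R : T.RotationSystem) (d : T.Dart) (i : ℕ) (x y : T.Dart),
          R.Search c k g SimpleGraph.RotationSystem.Phase.overload d d i x y ∧
          S = R.tourSubtree x y) ∧
        RAM.Exec RAM.treeProgram (RAM.inputStore k g c num ends) n τ ∧ n ≤ 2000 * N₁ ∧
        RAM.Outputs num τ S.verts := by
    intro num ends hends
    -- A single vertex has no darts, hence no tour; it is itself the subtree, of weight `N₂ ≥ k`.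
    rcases Nat.lt_or_ge N₁ 2 with hN | hN
    · obtain ⟨v⟩ := hT.connected.nonempty
      have hN1 : N₁ = 1 := by
        have := Fintype.card_pos_iff.2 ⟨v⟩
        omega
      have hsub : Subsingleton V := Fintype.card_le_one_iff_subsingleton.1 (by omega)
      have hw : SimpleGraph.subgraphWeight c (T.singletonSubgraph v) = c v := by
        rw [SimpleGraph.subgraphWeight, Finset.sum_eq_single v]
        · exact fun w _ hw => absurd (Subsingleton.elim w v) hw
        · simp
      have hcv : c v = N₂ := by
        rw [← hN₂, Finset.sum_eq_single v]
        · exact fun w _ hw => absurd (Subsingleton.elim w v) hw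
        · simp
      refine ⟨T.singletonSubgraph v, _, _, ⟨SimpleGraph.IsTree.coe_singletonSubgraph T v, ?_, ?_⟩,
        fun h => absurd h (by omega), .ifTrue ?_ (.write _ _ _ _), ?_, fun w => ?_⟩
      · rw [hw]
        omega
      · rw [hw]
        exact hck v
      · simpa [RAM.Operand.eval, RAM.inputStore] using hN
      · simp only [RAM.Operand.cost]
        omega
      · have h0 : ((num w : Fin N₁) : ℕ) = 0 := by
          have := (num w).2
          omega
        refine ⟨fun _ => ?_, fun hv => absurd (Subsingleton.elim w v) hv⟩
        simp [RAM.Store.setArr_arr, RAM.Operand.eval, h0]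
    · obtain ⟨n, τ, he, hn, R, d, i, a, b, hp, hout⟩ :=
        RAM.runs_treeProgram hT hN₁ hN hpath num (by omega) hends
      obtain ⟨hab, hba, hge, hle⟩ := hp.good
      obtain ⟨j, -, hs⟩ := hp.search R hT d .overload
      refine ⟨R.tourSubtree (R.tourNext^[a] d) (R.tourNext^[b] d), n, τ,
        R.isSubtreeOfWeight_tourSubtree hT d hab hba hge hle,
        fun _ => ⟨R, d, j, _, _, hs, rfl⟩, he, hn, ?_⟩
      rwa [R.tourSubtree_verts hT d hab hba]
  refine ⟨?_, fun R d => ?_, hprog⟩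
  -- The program, unlike the search, also covers the tree with one vertex.
  · obtain ⟨ends, hends⟩ := RAM.listsEdges_exists hT hN₁
    obtain ⟨S, -, -, hS, -⟩ := hprog (Fintype.equivFinOfCardEq hN₁) ends hends
    exact ⟨S, hS⟩
  · obtain ⟨n, hn, a, b, hp⟩ := hpath R d
    obtain ⟨hab, hba, hge, hle⟩ := hp.good
    obtain ⟨j, hj, hs⟩ := hp.search R hT d .overload
    have : 0 < N₁ := hN₁ ▸ Fintype.card_pos_iff.2 ⟨d.fst⟩
    exact ⟨j, _, _, hs, by omega, R.isSubtreeOfWeight_tourSubtree hT d hab hba hge hle⟩
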